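/- **Setting.** Let $f=f_0+f_1$ on $\mathbb R^n$, where $f_1:\mathbb R^n\to\overline{\mathbb R}$ is proper, lower semicontinuous and convex, $f_0:\mathbb R^n\to\mathbb R$ is continuously differentiable on an open set containing $\overline{\mathrm{dom}(f_1)}$, $\nabla f_0$ is $L$-Lipschitz on $\mathrm{dom}(f_1)$ for some $L>0$, and $f$ is bounded from below. For a proper, lower semicontinuous $F$, let $\partial F$ be the limiting subdifferential (limits of Fréchet subgradients $w^{(k)}\in\hat\partial F(z^{(k)})$ with $z^{(k)}\to z$, $F(z^{(k)})\to F(z)$, for $z\in\mathrm{dom}(F)$); $z$ is stationary for $F$ if $0\in\partial F(z)$; and $\|\partial F(z)\|_-=\inf_{v\in\partial F(z)}\|v\|$ ($=+\infty$ if $\partial F(z)=\emptyset$). $F$ is a KL function if for every $\bar z$ with $\partial F(\bar z)\ne\emptyset$ there are $\upsilon\in(0,+\infty]$, a neighbourhood $U$ of $\bar z$ and a continuous concave $\phi:[0,\upsilon)\to[0,+\infty)$ with $\phi(0)=0$, $\phi\in C^1(0,\upsilon)$, $\phi'>0$ on $(0,\upsilon)$, such that $\phi'(F(z)-F(\bar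 z))\,\|\partial F(z)\|_-\ge 1$ for all $z\in U$ with $F(\bar z)<F(z)<F(\bar z)+\upsilon$. **Algorithm (iPila).** Fix $\sigma,\delta\in(0,1)$, $0<\alpha_{\min}\le\alpha_{\max}$, $\beta_{\max}>0$, $0<\gamma_{\min}\le\gamma_{\max}$, $\tau\ge0$, and put $\Phi(x,s)=f(x)+\frac12\|x-s\|^2$ and $$h_{\alpha,\beta}(y;x,s)=f_1(y)-f_1(x)+\Big\langle\nabla f_0(x)-\frac{\beta}{\alpha}(x-s),\,y-x\Big\rangle+\frac1{2\alpha}\|y-x\|^2 .$$ Start from $x^{(0)}\in\mathrm{dom}(f_1)$, $s^{(0)}\in\mathbb R^n$. At iteration $k=0,1,\dots$: 1. choose $\alpha_k\in[\alpha_{\min},\alpha_{\max}]$, $\beta_k\in[0,\beta_{\max}]$, $\gamma_k\in[\gamma_{\min},\gamma_{\max}]$, and write $h^{(k)}=h_{\alpha_k,\beta_k}(\cdot\,;x^{(k)},s^{(k)})$; 2. take any $\tilde y^{(k)}\in\mathrm{dom}(f_1)$ with $0\in\partial_{\epsilon_k}h^{(k)}(\tilde y^{(k)})$, $\epsilon_k=-\frac\tau2h^{(k)}(\tilde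 y^{(k)})$, that is, $h^{(k)}(y)\ge h^{(k)}(\tilde y^{(k)})-\epsilon_k$ for all $y\in\mathbb R^n$; 3. set $\Delta_k=h^{(k)}(\tilde y^{(k)})-\gamma_k\|x^{(k)}-s^{(k)}\|^2$, $d_x^{(k)}=\tilde y^{(k)}-x^{(k)}$, $d_s^{(k)}=(1+\frac{\beta_k}{\alpha_k})(\tilde y^{(k)}-x^{(k)})+\gamma_k(x^{(k)}-s^{(k)})$; 4. (line search) let $\lambda_k$ be the first $\lambda$ among $1,\delta,\delta^2,\dots$ with $\Phi(x^{(k)}+\lambda d_x^{(k)},s^{(k)}+\lambda d_s^{(k)})\le\Phi(x^{(k)},s^{(k)})+\sigma\lambda\Delta_k$; 5. set $(x^{(k+1)},s^{(k+1)})=(\tilde y^{(k)},x^{(k)})$ if $\Phi(\tilde y^{(k)},x^{(k)})\le\Phi(x^{(k)},s^{(k)})+\sigma\lambda_k\Delta_k$, and $(x^{(k+1)},s^{(k+1)})=(x^{(k)}+\lambda_kd_x^{(k)},s^{(k)}+\lambda_kd_s^{(k)})$ otherwise. **Theorem.** (a) There is $\lambda_{\min}>0$ such that, for every $(x^{(k)},s^{(k)})\in\mathrm{dom}(f_1)\times\mathbb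 R^n$ and all choices in steps 1 and 2, the line search in step 4 terminates after finitely many trials and returns $\lambda_k\ge\lambda_{\min}$. (b) Suppose that $\mathcal F:\mathbb R^n\times\mathbb R\to\overline{\mathbb R}$, $\mathcal F(u,\rho)=f(u)+\frac12\rho^2$, is a KL function. If a sequence $\{x^{(k)}\}_{k\in\mathbb N}$ generated by iPila is bounded, then it converges to a stationary point of $f$. -/

import Mathlib

open Filter Topology

noncomputable section

namespace IPila

section General

variable {E : Type*} [NormedAddCommGroup E] [InnerProductSpace ℝ E]

/-- Effective domain of an extended-real-valued function. -/
def dom (F : E → EReal) : Set E := {x | F x < ⊤}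

/-- Nonempty domain, and finite on it. -/
def IsProper (F : E → EReal) : Prop :=
  (dom F).Nonempty ∧ ∀ x ∈ dom F, F x ≠ ⊥

/-- Convexity of an extended-real-valued function (used for proper functions, so that the right-hand
side never contains `⊤ + ⊥`; note `0 * ⊤ = 0` in `EReal`). -/
def IsConvex (F : E → EReal) : Prop :=
  ∀ x y : E, ∀ a b : ℝ, 0 ≤ a → 0 ≤ b → a + b = 1 →
    F (a • x + b • y) ≤ (a : EReal) * F x + (b : EReal) * F y

/-- Fréchet subdifferential (empty outside the domain). -/
def frechetSubdiff (F : E → EReal) (z : E) : Set E :=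
  {w | z ∈ dom F ∧
    0 ≤ liminf (fun u : E =>
      (F u - F z - ((inner ℝ (u - z) w : ℝ) : EReal)) / ((‖u - z‖ : ℝ) : EReal)) (𝓝[≠] z)}

/-- Limiting subdifferential (empty outside the domain). -/
def limitingSubdiff (F : E → EReal) (z : E) : Set E :=
  {w | z ∈ dom F ∧ ∃ (zs ws : ℕ → E),
    Tendsto zs atTop (𝓝 z) ∧ Tendsto (fun k => F (zs k)) atTop (𝓝 (F z)) ∧
    (∀ k, ws k ∈ frechetSubdiff F (zs k)) ∧ Tendsto ws atTop (𝓝 w)}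

/-- Stationary points: `0 ∈ ∂F(z)`. -/
def IsStationary (F : E → EReal) (z : E) : Prop := 0 ∈ limitingSubdiff F z

/-- Lazy slope: the infimum of `‖v‖` over `v ∈ ∂F(z)`, equal to `+∞` when `∂F(z)` is empty. -/
def lazySlope (F : E → EReal) (z : E) : ENNReal :=
  ⨅ v ∈ limitingSubdiff F z, ENNReal.ofReal ‖v‖

/-- `φ : [0,υ) → [0,∞)` is continuous and concave, `φ 0 = 0`, and it is `C¹` with positive derivative
on `(0,υ)`; `υ = ⊤` is allowed. -/
structure IsDesingularizing (υ : EReal) (φ : ℝ → ℝ) : Prop where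
  continuousOn : ContinuousOn φ {t : ℝ | 0 ≤ t ∧ (t : EReal) < υ}
  concaveOn : ConcaveOn ℝ {t : ℝ | 0 ≤ t ∧ (t : EReal) < υ} φ
  nonneg : ∀ t : ℝ, 0 ≤ t → (t : EReal) < υ → 0 ≤ φ t
  map_zero : φ 0 = 0
  contDiffOn : ContDiffOn ℝ 1 φ {t : ℝ | 0 < t ∧ (t : EReal) < υ}
  deriv_pos : ∀ t : ℝ, 0 < t → (t : EReal) < υ → 0 < deriv φ t

/-- The Kurdyka–Łojasiewicz property at `z`. In the region where the inequality is required,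
`F u` and `F z` are finite when `F` is proper and `z ∈ dom F`, so `toReal` is the honest
real difference. -/
def HasKLAt (F : E → EReal) (z : E) : Prop :=
  ∃ (υ : EReal) (U : Set E) (φ : ℝ → ℝ), 0 < υ ∧ U ∈ 𝓝 z ∧ IsDesingularizing υ φ ∧
    ∀ u ∈ U, F z < F u → F u < F z + υ →
      1 ≤ ENNReal.ofReal (deriv φ (F u - F z).toReal) * lazySlope F u

/-- KL function: the KL property holds at every point where the limiting subdifferential is
nonempty. -/
def IsKLFunction (F : E → EReal) : Prop :=
  ∀ z, (limitingSubdiff F z).Nonempty → HasKLAt F z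

/-- The `ε`-subdifferential of convex analysis. -/
def epsSubdiff (ε : ℝ) (g : E → EReal) (z : E) : Set E :=
  {w | ∀ y, g z + ((inner ℝ w (y - z) - ε : ℝ) : EReal) ≤ g y}

/-- The objective `f = f₀ + f₁`. -/
def objective (f₀ : E → ℝ) (f₁ : E → EReal) (x : E) : EReal := (f₀ x : EReal) + f₁ x

/-- `F(u, ρ) = f(u) + ρ²/2` on the Euclidean product `E × ℝ`. -/
def meritF (f : E → EReal) (z : WithLp 2 (E × ℝ)) : EReal :=
  f z.fst + ((z.snd ^ 2 / 2 : ℝ) : EReal)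

/-- `Φ(x, s) = f(x) + ½‖x - s‖²`. -/
def meritPhi (f : E → EReal) (x s : E) : EReal := f x + ((‖x - s‖ ^ 2 / 2 : ℝ) : EReal)

end General

section Algorithm

variable {E : Type*} [NormedAddCommGroup E] [InnerProductSpace ℝ E] [CompleteSpace E]

/-- The composite setting: `f₁` proper, lower semicontinuous and convex; `f₀` continuously
differentiable on an open set containing the closure of `dom f₁`, with `L`-Lipschitz gradient on
`dom f₁`; `f₀ + f₁` bounded below. -/
structure CompositeSetting (f₀ : E → ℝ) (f₁ : E → EReal) (L : ℝ) : Prop where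
  proper : IsProper f₁
  lsc : LowerSemicontinuous f₁
  convex : IsConvex f₁
  smooth : ∃ Ω₀ : Set E, IsOpen Ω₀ ∧ closure (dom f₁) ⊆ Ω₀ ∧ ContDiffOn ℝ 1 f₀ Ω₀
  L_pos : 0 < L
  lipschitz : ∀ x ∈ dom f₁, ∀ y ∈ dom f₁, ‖gradient f₀ x - gradient f₀ y‖ ≤ L * ‖x - y‖
  bddBelow : ∃ m : ℝ, ∀ x, (m : EReal) ≤ objective f₀ f₁ x

/-- The user-chosen constants of iPila and of its backtracking line search. -/
structure Params where
  σ : ℝ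
  δ : ℝ
  αmin : ℝ
  αmax : ℝ
  βmax : ℝ
  γmin : ℝ
  γmax : ℝ
  τ : ℝ
  σ_pos : 0 < σ
  σ_lt_one : σ < 1
  δ_pos : 0 < δ
  δ_lt_one : δ < 1
  αmin_pos : 0 < αmin
  αmin_le : αmin ≤ αmax
  βmax_pos : 0 < βmax
  γmin_pos : 0 < γmin
  γmin_le : γmin ≤ γmax
  τ_nonneg : 0 ≤ τ

/-- The function `y ↦ h(y; x, s)` minimized by the inertial proximal gradient point. -/
def hFun (f₀ : E → ℝ) (f₁ : E → EReal) (α β : ℝ) (x s y : E) : EReal :=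
  f₁ y - f₁ x +
    ((inner ℝ (gradient f₀ x - (β / α) • (x - s)) (y - x) + 1 / (2 * α) * ‖y - x‖ ^ 2 : ℝ) : EReal)

/-- The inexactness criterion: `y ∈ dom f₁` and `0 ∈ ∂_ε h(y; x, s)` with `ε = -(τ/2) h(y; x, s)`.
For `x, y ∈ dom f₁` the value `h(y; x, s)` is finite. -/
def IsInexactProx (f₀ : E → ℝ) (f₁ : E → EReal) (τ α β : ℝ) (x s y : E) : Prop :=
  y ∈ dom f₁ ∧
    0 ∈ epsSubdiff (-(τ / 2) * (hFun f₀ f₁ α β x s y).toReal) (hFun f₀ f₁ α β x s) y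

/-- `Δ = h(y; x, s) - γ‖x - s‖²` (a real number for `x, y ∈ dom f₁`). -/
def Delta (f₀ : E → ℝ) (f₁ : E → EReal) (α β γ : ℝ) (x s y : E) : ℝ :=
  (hFun f₀ f₁ α β x s y).toReal - γ * ‖x - s‖ ^ 2

/-- The `x`-component of the search direction. -/
def dirX (x y : E) : E := y - x

/-- The `s`-component of the search direction. -/
def dirS (α β γ : ℝ) (x s y : E) : E := (1 + β / α) • (y - x) + γ • (x - s)

/-- The generalized Armijo inequality with step `lam`. -/
def Armijo (f₀ : E → ℝ) (f₁ : E → EReal) (σ α β γ : ℝ) (x s y : E) (lam : ℝ) : Prop :=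
  meritPhi (objective f₀ f₁) (x + lam • dirX x y) (s + lam • dirS α β γ x s y) ≤
    meritPhi (objective f₀ f₁) x s + ((σ * lam * Delta f₀ f₁ α β γ x s y : ℝ) : EReal)

/-- The backtracking line search, which tries `1, δ, δ², …` in this order and stops at the first
step that satisfies the Armijo inequality, terminates and returns `lam`. -/
def LineSearchReturns (f₀ : E → ℝ) (f₁ : E → EReal) (σ δ α β γ : ℝ) (x s y : E) (lam : ℝ) : Prop :=
  ∃ m : ℕ, IsLeast {j : ℕ | Armijo f₀ f₁ σ α β γ x s y (δ ^ j)} m ∧ lam = δ ^ m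

/-- The acceptance test for the inexact inertial proximal gradient point `y`. -/
def Accepts (f₀ : E → ℝ) (f₁ : E → EReal) (σ α β γ : ℝ) (x s y : E) (lam : ℝ) : Prop :=
  meritPhi (objective f₀ f₁) y x ≤
    meritPhi (objective f₀ f₁) x s + ((σ * lam * Delta f₀ f₁ α β γ x s y : ℝ) : EReal)

/-- `(x k)`, `(s k)` are iterates generated by iPila with parameters `P`, where `α k`, `β k`, `γ k`
are the chosen parameters, `y k` the inexact inertial proximal gradient points and `lam k` the step
returned by the line search. -/
structure IsRun (f₀ : E → ℝ) (f₁ : E → EReal) (P : Params) (α β γ lam : ℕ → ℝ)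
    (x s y : ℕ → E) : Prop where
  init : x 0 ∈ dom f₁
  α_mem : ∀ k, α k ∈ Set.Icc P.αmin P.αmax
  β_mem : ∀ k, β k ∈ Set.Icc 0 P.βmax
  γ_mem : ∀ k, γ k ∈ Set.Icc P.γmin P.γmax
  prox : ∀ k, IsInexactProx f₀ f₁ P.τ (α k) (β k) (x k) (s k) (y k)
  lineSearch : ∀ k,
    LineSearchReturns f₀ f₁ P.σ P.δ (α k) (β k) (γ k) (x k) (s k) (y k) (lam k)
  step_accept : ∀ k, Accepts f₀ f₁ P.σ (α k) (β k) (γ k) (x k) (s k) (y k) (lam k) →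
    x (k + 1) = y k ∧ s (k + 1) = x k
  step_reject : ∀ k, ¬ Accepts f₀ f₁ P.σ (α k) (β k) (γ k) (x k) (s k) (y k) (lam k) →
    x (k + 1) = x k + lam k • dirX (x k) (y k) ∧
    s (k + 1) = s k + lam k • dirS (α k) (β k) (γ k) (x k) (s k) (y k)

end Algorithm

end IPila

end

open Filter Topology

noncomputable section

namespace IPila

/-! ### Extended-real calculus, subgradients and desingularizing functions. -/

section General

set_option linter.unusedSectionVars false

variable {E : Type*} [NormedAddCommGroup E] [InnerProductSpace ℝ E] {F : E → EReal}

/-! Everything is measured by `D = -Delta`. The model `h` is strongly convex and vanishes at `x`,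
while inexactness says that `(1 + τ/2) h(y)` is a lower bound for `h`. Hence `h(y) ≤ 0`, and `D`
dominates, up to constants, the squares of `‖y - x‖` and `‖x - s‖` (`IsInexactProx.norm_bounds`).
Along the search direction the first-order change of the merit function is at most `-t D` and the
second-order change is at most a constant times `t² D`, so all short steps pass the Armijo test
(`exists_armijo_of_le`). This gives the uniform lower bound on the step, and with it a decrease of
the merit values by at least `c D` per iteration.

For convergence, the inexact point `y` carries no usable subgradient, so the exact minimizer `u` of
`h` is used as a companion. It lies within `O(√D)` of `x`, has a subgradient of `f` of size `O(√D)`,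
and satisfies `Φ(y, x) ≤ f(u) + C D` (`exists_prox_estimates`). The scalar variable of the KL
function absorbs the error: with `ρ = √(2 C D)`, the value of the KL function at `(u, ρ)` lies above
the next merit value, and its subgradient there is still `O(√D)`. Concavity of the desingularizing
function lets the KL inequality at this higher level control the following merit decrease. An
arithmetic-geometric mean inequality turns this into a recursion for `√D`
(`two_mul_le_of_desingularizing`), which gives finite length and convergence to a cluster point
(`tendsto_of_localized_recursion`). Such a point is stationary by closedness of the convex
subdifferential (`CompositeSetting.optimality_of_tendsto`). -/

lemma IsProper.ne_bot (hF : IsProper F) (x : E) : F x ≠ ⊥ := fun h =>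
  hF.2 x (by simp [dom, h]) h

lemma IsProper.coe_toReal (hF : IsProper F) {x : E} (hx : x ∈ dom F) :
    ((F x).toReal : EReal) = F x :=
  EReal.coe_toReal (ne_of_lt hx) (hF.ne_bot x)

lemma mem_dom_of_le_coe {x : E} {r : ℝ} (h : F x ≤ r) : x ∈ dom F :=
  lt_of_le_of_lt h (EReal.coe_lt_top r)

lemma IsProper.toReal_le (hF : IsProper F) {x : E} {r : ℝ} (h : F x ≤ r) : (F x).toReal ≤ r := by
  rw [← hF.coe_toReal (mem_dom_of_le_coe h)] at h
  exact EReal.coe_le_coe_iff.1 h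

lemma IsConvex.le_coe (hF : IsProper F) (hc : IsConvex F) {x y : E} (hx : x ∈ dom F)
    (hy : y ∈ dom F) {a b : ℝ} (ha : 0 ≤ a) (hb : 0 ≤ b) (hab : a + b = 1) :
    F (a • x + b • y) ≤ ((a * (F x).toReal + b * (F y).toReal : ℝ) : EReal) := by
  have h := hc x y a b ha hb hab
  rw [← hF.coe_toReal hx, ← hF.coe_toReal hy] at h
  exact_mod_cast h

lemma IsConvex.convexOn_toReal (hF : IsProper F) (hc : IsConvex F) :
    ConvexOn ℝ (dom F) (fun x => (F x).toReal) :=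
  ⟨fun _ hx _ hy _ _ ha hb hab => mem_dom_of_le_coe (hc.le_coe hF hx hy ha hb hab),
    fun _ hx _ hy _ _ ha hb hab => hF.toReal_le (hc.le_coe hF hx hy ha hb hab)⟩

/-- A lower semicontinuous function is bounded at a limit point by the limit of upper bounds. -/
lemma le_coe_of_tendsto {ι : Type*} {l : Filter ι} [l.NeBot] (hF : LowerSemicontinuous F)
    {u : ι → E} {x : E} {c : ι → ℝ} {r : ℝ} (hu : Tendsto u l (𝓝 x)) (hc : Tendsto c l (𝓝 r))
    (h : ∀ i, F (u i) ≤ c i) : F x ≤ r := by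
  by_contra! hlt
  obtain ⟨q, hq, hq'⟩ := exists_between hlt
  have h1 : ∀ᶠ i in l, q < F (u i) := hu.eventually (hF x q hq')
  have h2 : ∀ᶠ i in l, (c i : EReal) < q :=
    ((continuous_coe_real_ereal.tendsto r).comp hc).eventually_lt_const hq
  obtain ⟨i, hi1, hi2⟩ := (h1.and h2).exists
  exact absurd (h i) (not_le.2 (hi2.trans hi1))

lemma frechetSubdiff_subset_limitingSubdiff (F : E → EReal) (z : E) :
    frechetSubdiff F z ⊆ limitingSubdiff F z := fun w hw =>
  ⟨hw.1, fun _ => z, fun _ => w, tendsto_const_nhds, tendsto_const_nhds, fun _ => hw,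
    tendsto_const_nhds⟩

/-- A lower bound by an affine function up to a `o(‖u - z‖)` term gives a Fréchet subgradient. -/
lemma mem_frechetSubdiff_of_isLittleO {z w : E} {c : ℝ} (hz : F z = c) {r : E → ℝ}
    (hr : r =o[𝓝 z] fun u => u - z)
    (h : ∀ u, ((c + inner ℝ w (u - z) + r u : ℝ) : EReal) ≤ F u) : w ∈ frechetSubdiff F z := by
  refine ⟨mem_dom_of_le_coe hz.le, ?_⟩
  refine le_of_forall_lt fun q hq => ?_
  obtain ⟨e, hqe, he⟩ := EReal.lt_iff_exists_real_btwn.1 hq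
  have he' : e < 0 := by exact_mod_cast he
  refine hqe.trans_le (le_liminf_of_le (by isBoundedDefault) ?_)
  have h1 := (hr.def (neg_pos.2 he')).filter_mono (nhdsWithin_le_nhds (s := {z}ᶜ))
  filter_upwards [h1, self_mem_nhdsWithin] with u hu hne
  have hpos : 0 < ‖u - z‖ := norm_pos_iff.2 (sub_ne_zero.2 hne)
  rw [EReal.le_div_iff_mul_le (by exact_mod_cast hpos) (EReal.coe_ne_top _), hz]
  have hub := h u
  have hnb : F u ≠ ⊥ := fun hb => by simp [hb] at hub
  by_cases ht : F u = ⊤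
  · rw [ht]
    simp
  · rw [← EReal.coe_toReal ht hnb] at hub ⊢
    have hub' := EReal.coe_le_coe_iff.1 hub
    rw [real_inner_comm]
    rw [Real.norm_eq_abs] at hu
    have := (abs_le.1 hu).1
    have : e * ‖u - z‖ ≤ (F u).toReal - c - inner ℝ w (u - z) := by linarith
    exact_mod_cast this

/-- Chord slopes of a concave function decrease to the right, so the derivative at a point is at
most the slope of any chord to its left. Allowing `t` strictly above `t₂` matters because the KL
inequality is evaluated at a level above the merit values being compared. -/
lemma IsDesingularizing.deriv_mul_sub_le {υ : EReal} {φ : ℝ → ℝ} (hφ : IsDesingularizing υ φ)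
    {t₁ t₂ t : ℝ} (h₀ : 0 ≤ t₁) (h₁₂ : t₁ ≤ t₂) (h₂ : t₂ ≤ t) (ht : 0 < t) (htυ : (t : EReal) < υ) :
    deriv φ t * (t₂ - t₁) ≤ φ t₂ - φ t₁ := by
  have hS : ∀ q : ℝ, 0 ≤ q → q ≤ t → q ∈ {q : ℝ | 0 ≤ q ∧ (q : EReal) < υ} := fun q hq hqt =>
    ⟨hq, lt_of_le_of_lt (EReal.coe_le_coe_iff.2 hqt) htυ⟩
  have hopen : IsOpen {q : ℝ | 0 < q ∧ (q : EReal) < υ} :=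
    (isOpen_lt continuous_const continuous_id).inter
      (isOpen_lt continuous_coe_real_ereal continuous_const)
  have hd : DifferentiableAt ℝ φ t :=
    (hφ.contDiffOn.differentiableOn one_ne_zero).differentiableAt (hopen.mem_nhds ⟨ht, htυ⟩)
  have key : ∀ q : ℝ, 0 ≤ q → q < t → deriv φ t ≤ slope φ q t := fun q hq hqt =>
    hφ.concaveOn.deriv_le_slope (hS q hq hqt.le) (hS t ht.le le_rfl) hqt hd
  rcases h₁₂.eq_or_lt with rfl | h₁₂
  · simp
  have hslope : deriv φ t ≤ (φ t₂ - φ t₁) / (t₂ - t₁) := by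
    rcases h₂.eq_or_lt with rfl | h₂
    · simpa [slope_def_field] using key t₁ h₀ h₁₂
    · refine (key t₂ (h₀.trans h₁₂.le) h₂).trans ?_
      rw [slope_def_field]
      exact hφ.concaveOn.slope_anti_adjacent (hS t₁ h₀ (h₁₂.trans h₂).le) (hS t ht.le le_rfl) h₁₂ h₂
  exact (le_div_iff₀ (sub_pos.2 h₁₂)).1 hslope

lemma one_le_deriv_mul_of_mem_limitingSubdiff {φ : ℝ → ℝ} {z v : E} {t η : ℝ}
    (h : 1 ≤ ENNReal.ofReal (deriv φ t) * lazySlope F z) (hv : v ∈ limitingSubdiff F z)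
    (hη : ‖v‖ ≤ η) (hd : 0 ≤ deriv φ t) : 1 ≤ deriv φ t * η := by
  have h1 : lazySlope F z ≤ ENNReal.ofReal η :=
    (iInf₂_le v hv).trans (ENNReal.ofReal_le_ofReal hη)
  have h2 : (1 : ENNReal) ≤ ENNReal.ofReal (deriv φ t * η) := by
    rw [ENNReal.ofReal_mul hd]
    exact h.trans (mul_le_mul_right h1 _)
  exact ENNReal.one_le_ofReal.1 h2

end General

/-- The finite-length argument behind convergence under a Kurdyka–Łojasiewicz inequality: the
recursion is only required while the iterate is close to the cluster point `a`. -/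
lemma tendsto_of_localized_recursion {X : Type*} [MetricSpace X] [CompleteSpace X]
    {x : ℕ → X} {a : X} {d ψ : ℕ → ℝ} {p r : ℝ} {K : ℕ} (hr : 0 < r) (hp : 0 ≤ p)
    (hd : ∀ k, 0 ≤ d k) (hψ : ∀ k, K ≤ k → 0 ≤ ψ k) (hd0 : Tendsto d atTop (𝓝 0))
    (hψ0 : Tendsto ψ atTop (𝓝 0)) (hx : ∀ k, dist (x k) (x (k + 1)) ≤ p * d k)
    (ha : MapClusterPt a atTop x)
    (hrec : ∀ k, K ≤ k → dist (x k) a < r → 2 * d (k + 1) ≤ d k + ψ (k + 1) - ψ (k + 2)) :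
    Tendsto x atTop (𝓝 a) := by
  have hsmall : ∀ᶠ k in atTop, p * (2 * d k + ψ (k + 1)) < r / 2 := by
    have : Tendsto (fun k => p * (2 * d k + ψ (k + 1))) atTop (𝓝 (p * (2 * 0 + 0))) :=
      ((hd0.const_mul 2).add ((tendsto_add_atTop_iff_nat 1).2 hψ0)).const_mul p
    exact this.eventually_lt_const (by simpa using half_pos hr)
  have hfreq : ∃ᶠ k in atTop, dist (x k) a < r / 2 :=
    ha.frequently (Metric.ball_mem_nhds a (half_pos hr))
  -- Half of the radius covers the distance from `x N` to `a`, the other half the length of the path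
  -- after `N`.
  obtain ⟨N, hN1, hN2, hNK⟩ :=
    (hfreq.and_eventually (hsmall.and (eventually_ge_atTop K))).exists
  have hdist : ∀ m, dist (x N) (x (N + m)) ≤ p * ∑ j ∈ Finset.range m, d (N + j) := by
    intro m
    rw [Finset.mul_sum]
    induction m with
    | zero => simp
    | succ m ih =>
      rw [Finset.sum_range_succ]
      exact (dist_triangle _ (x (N + m)) _).trans (add_le_add ih (hx (N + m)))
  -- The summed recursion: `ψ` telescopes, and of the doubled terms one copy accumulates in the sum
  -- while the other cancels against the next step. The bound at stage `m` keeps the iterate in the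
  -- ball, which licenses the recursion for stage `m + 1`.
  have hinv : ∀ m, (∑ j ∈ Finset.range (m + 1), d (N + j)) + d (N + m) + ψ (N + m + 1) ≤
      2 * d N + ψ (N + 1) := by
    intro m
    induction m with
    | zero => simp; linarith
    | succ m ih =>
      have hball : dist (x (N + m)) a < r := by
        have h1 := hdist m
        have h2 : ∑ j ∈ Finset.range m, d (N + j) ≤ 2 * d N + ψ (N + 1) := by
          rw [Finset.sum_range_succ] at ih
          linarith [hd (N + m), hψ (N + m + 1) (by omega)]
        have h3 := mul_le_mul_of_nonneg_left h2 hp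
        have h4 := dist_triangle (x (N + m)) (x N) a
        rw [dist_comm (x (N + m)) (x N)] at h4
        linarith
      have h := hrec (N + m) (by omega) hball
      rw [Finset.sum_range_succ]
      simp only [← add_assoc] at h ⊢
      have e : N + m + 1 + 1 = N + m + 2 := rfl
      rw [e]
      linarith
  have hsum : Summable fun j => d (N + j) := by
    refine summable_of_sum_range_le (c := 2 * d N + ψ (N + 1)) (fun j => hd _) fun m => ?_
    have := hinv m
    rw [Finset.sum_range_succ] at this
    linarith [hd (N + m), hψ (N + m + 1) (by omega)]
  have hcau : CauchySeq fun j => x (N + j) :=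
    cauchySeq_of_dist_le_of_summable (fun j => p * d (N + j)) (fun j => hx (N + j))
      (hsum.mul_left p)
  obtain ⟨b, hb⟩ := cauchySeq_tendsto_of_complete hcau
  have hb' : Tendsto x atTop (𝓝 b) := by
    refine (tendsto_add_atTop_iff_nat N).1 ?_
    simpa [add_comm] using hb
  obtain ⟨θ, hθ, hxa⟩ := MapClusterPt.tendsto_subseq ha
  rwa [tendsto_nhds_unique hxa (hb'.comp hθ.tendsto_atTop)]

/-! ### The proximal model, its exact minimizer, and the descent lemma. -/

section Prox

set_option linter.unusedSectionVars false

variable {E : Type*} [NormedAddCommGroup E] [InnerProductSpace ℝ E] [CompleteSpace E]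
  {f₀ : E → ℝ} {f₁ : E → EReal} {L : ℝ}

/-- The real-valued version of the objective, meaningful on `dom f₁`. -/
def realObjective (f₀ : E → ℝ) (f₁ : E → EReal) (x : E) : ℝ := f₀ x + (f₁ x).toReal

/-- The real-valued version of `meritPhi`, meaningful for `x ∈ dom f₁`. -/
def realPhi (f₀ : E → ℝ) (f₁ : E → EReal) (x s : E) : ℝ :=
  realObjective f₀ f₁ x + ‖x - s‖ ^ 2 / 2

/-- The real-valued version of `hFun`, meaningful on `dom f₁`. -/
def realH (f₀ : E → ℝ) (f₁ : E → EReal) (α β : ℝ) (x s y : E) : ℝ :=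
  (f₁ y).toReal - (f₁ x).toReal +
    (inner ℝ (gradient f₀ x - (β / α) • (x - s)) (y - x) + 1 / (2 * α) * ‖y - x‖ ^ 2)

lemma IsProper.objective_eq_coe (h₁ : IsProper f₁) {x : E} (hx : x ∈ dom f₁) :
    objective f₀ f₁ x = (realObjective f₀ f₁ x : ℝ) := by
  rw [objective, ← h₁.coe_toReal hx, ← EReal.coe_add, realObjective]

lemma IsProper.meritPhi_eq_coe (h₁ : IsProper f₁) {x : E} (hx : x ∈ dom f₁) (s : E) :
    meritPhi (objective f₀ f₁) x s = (realPhi f₀ f₁ x s : ℝ) := by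
  rw [meritPhi, h₁.objective_eq_coe hx, ← EReal.coe_add, realPhi]

lemma IsProper.hFun_eq_coe (h₁ : IsProper f₁) {x y : E} (hx : x ∈ dom f₁) (hy : y ∈ dom f₁)
    (α β : ℝ) (s : E) : hFun f₀ f₁ α β x s y = (realH f₀ f₁ α β x s y : ℝ) := by
  rw [hFun, ← h₁.coe_toReal hx, ← h₁.coe_toReal hy, ← EReal.coe_sub, ← EReal.coe_add, realH]

lemma IsProper.delta_eq (h₁ : IsProper f₁) {x y : E} (hx : x ∈ dom f₁) (hy : y ∈ dom f₁)
    (α β γ : ℝ) (s : E) :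
    Delta f₀ f₁ α β γ x s y = realH f₀ f₁ α β x s y - γ * ‖x - s‖ ^ 2 := by
  rw [Delta, h₁.hFun_eq_coe hx hy, EReal.toReal_coe]

@[simp] lemma realH_self (α β : ℝ) (x s : E) : realH f₀ f₁ α β x s x = 0 := by
  simp [realH]

lemma IsInexactProx.le_realH (h₁ : IsProper f₁) {τ α β : ℝ} {x s y z : E}
    (hp : IsInexactProx f₀ f₁ τ α β x s y) (hx : x ∈ dom f₁) (hz : z ∈ dom f₁) :
    (1 + τ / 2) * realH f₀ f₁ α β x s y ≤ realH f₀ f₁ α β x s z := by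
  have h := hp.2 z
  rw [h₁.hFun_eq_coe hx hz, h₁.hFun_eq_coe hx hp.1, EReal.toReal_coe, inner_zero_left,
    ← EReal.coe_add, EReal.coe_le_coe_iff] at h
  linarith

/-- The affine part is exact at midpoints, `f₁` is convex, and the parallelogram law for the
quadratic part yields the gain. -/
lemma realH_midpoint_le (h₁ : ConvexOn ℝ (dom f₁) fun x => (f₁ x).toReal) {u v : E}
    (hu : u ∈ dom f₁) (hv : v ∈ dom f₁) (α β : ℝ) (x s : E) :
    realH f₀ f₁ α β x s ((1 / 2 : ℝ) • u + (1 / 2 : ℝ) • v) ≤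
      (realH f₀ f₁ α β x s u + realH f₀ f₁ α β x s v) / 2 - 1 / (8 * α) * ‖u - v‖ ^ 2 := by
  have hg := h₁.2 hu hv (one_half_pos (α := ℝ)).le one_half_pos.le (by norm_num)
  simp only [smul_eq_mul] at hg
  have e1 : (1 / 2 : ℝ) • u + (1 / 2 : ℝ) • v - x =
      (1 / 2 : ℝ) • (u - x) + (1 / 2 : ℝ) • (v - x) := by module
  have e2 : u - v = (u - x) - (v - x) := by abel
  have e3 : ‖(1 / 2 : ℝ) • (u - x) + (1 / 2 : ℝ) • (v - x)‖ ^ 2 =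
      (‖u - x‖ ^ 2 + ‖v - x‖ ^ 2) / 2 - ‖u - v‖ ^ 2 / 4 := by
    rw [e2, norm_add_sq_real, norm_sub_sq_real (u - x) (v - x), norm_smul, norm_smul, real_inner_smul_left,
      real_inner_smul_right]
    norm_num
    ring
  simp only [realH]
  rw [e1, e3, inner_add_right, real_inner_smul_right, real_inner_smul_right]
  have e4 : 1 / (8 * α) = 1 / (2 * α) / 4 := by rw [div_div]; ring_nf
  rw [e4]
  linarith

/-- A lower bound for `realH` at the midpoint turns strong convexity into a distance estimate. -/
lemma norm_sub_sq_le_of_le_realH (h₁ : ConvexOn ℝ (dom f₁) fun x => (f₁ x).toReal) {u v : E}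
    (hu : u ∈ dom f₁) (hv : v ∈ dom f₁) {α β m : ℝ} (hα : 0 < α) {x s : E}
    (hm : ∀ z ∈ dom f₁, m ≤ realH f₀ f₁ α β x s z) :
    ‖u - v‖ ^ 2 ≤ 4 * α * (realH f₀ f₁ α β x s u + realH f₀ f₁ α β x s v - 2 * m) := by
  have h := realH_midpoint_le (f₀ := f₀) h₁ hu hv α β x s
  have h' := hm _ (h₁.1 hu hv (one_half_pos (α := ℝ)).le one_half_pos.le (by norm_num))
  have h'' : 1 / (8 * α) * ‖u - v‖ ^ 2 ≤
      (realH f₀ f₁ α β x s u + realH f₀ f₁ α β x s v) / 2 - m := by linarith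
  rw [one_div_mul_eq_div, div_le_iff₀ (by positivity)] at h''
  linarith

/-- Strong convexity makes a minimizing sequence Cauchy, so completeness replaces compactness; lower
semicontinuity passes the infimum to the limit. -/
lemma exists_isMinOn_realH (hf : CompositeSetting f₀ f₁ L) {α β m : ℝ} (hα : 0 < α) {x s : E}
    (hm : ∀ z ∈ dom f₁, m ≤ realH f₀ f₁ α β x s z) :
    ∃ u ∈ dom f₁, ∀ z ∈ dom f₁, realH f₀ f₁ α β x s u ≤ realH f₀ f₁ α β x s z := by
  have hconv := hf.convex.convexOn_toReal hf.proper
  set S := (fun z => realH f₀ f₁ α β x s z) '' dom f₁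
  have hne : S.Nonempty := hf.proper.1.image _
  have hbdd : BddBelow S := ⟨m, by rintro _ ⟨z, hz, rfl⟩; exact hm z hz⟩
  have hinf : ∀ z ∈ dom f₁, sInf S ≤ realH f₀ f₁ α β x s z := fun z hz =>
    csInf_le hbdd ⟨z, hz, rfl⟩
  obtain ⟨q, -, hq, hqS⟩ := exists_seq_tendsto_sInf hne hbdd
  choose u huD hu using hqS
  simp only at hu
  have hcau : CauchySeq u := by
    refine Metric.cauchySeq_iff.2 fun ε hε => ?_
    have hev : ∀ᶠ k in atTop, q k < sInf S + ε ^ 2 / (8 * α) :=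
      hq.eventually_lt_const (by linarith [show 0 < ε ^ 2 / (8 * α) by positivity])
    obtain ⟨N, hN⟩ := eventually_atTop.1 hev
    refine ⟨N, fun i hi j hj => ?_⟩
    have h := norm_sub_sq_le_of_le_realH hconv (huD i) (huD j) hα hinf
    rw [hu, hu] at h
    have h2 : 4 * α * (q i + q j - 2 * sInf S) < 4 * α * (2 * (ε ^ 2 / (8 * α))) :=
      mul_lt_mul_of_pos_left (by linarith [hN i hi, hN j hj]) (by positivity)
    have h3 : 4 * α * (2 * (ε ^ 2 / (8 * α))) = ε ^ 2 := by field_simp; norm_num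
    rw [dist_eq_norm]
    exact lt_of_pow_lt_pow_left₀ 2 hε.le (by linarith)
  obtain ⟨a, ha⟩ := cauchySeq_tendsto_of_complete hcau
  have hqcont : Continuous fun y : E =>
      inner ℝ (gradient f₀ x - (β / α) • (x - s)) (y - x) + 1 / (2 * α) * ‖y - x‖ ^ 2 := by
    fun_prop
  have hle := le_coe_of_tendsto hf.lsc ha
    ((hq.add_const (f₁ x).toReal).sub ((hqcont.tendsto a).comp ha)) (fun k => by
      rw [← hf.proper.coe_toReal (huD k), EReal.coe_le_coe_iff, ← hu k]
      simp only [realH, Function.comp_apply]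
      linarith)
  refine ⟨a, mem_dom_of_le_coe hle, fun z hz => le_trans ?_ (hinf z hz)⟩
  have := hf.proper.toReal_le hle
  simp only [realH]
  linarith

/-- The optimality condition of the proximal problem. -/
lemma subgradient_of_isMinOn_realH (h₁ : ConvexOn ℝ (dom f₁) fun x => (f₁ x).toReal)
    {α β : ℝ} (hα : 0 < α) {x s u z : E} (hu : u ∈ dom f₁) (hz : z ∈ dom f₁)
    (hmin : ∀ z ∈ dom f₁, realH f₀ f₁ α β x s u ≤ realH f₀ f₁ α β x s z) :
    (f₁ u).toReal + inner ℝ (-(gradient f₀ x - (β / α) • (x - s)) - (1 / α) • (u - x)) (z - u) ≤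
      (f₁ z).toReal := by
  set v := gradient f₀ x - (β / α) • (x - s) with hv
  set A := (f₁ z).toReal - (f₁ u).toReal + inner ℝ (v + (1 / α) • (u - x)) (z - u) with hA
  -- Minimality along the segment from `u` to `z`, divided by `t`; the first-order condition remains
  -- as `t` tends to `0`.
  have key : ∀ t : ℝ, 0 < t → t ≤ 1 → 0 ≤ A + t * (1 / (2 * α) * ‖z - u‖ ^ 2) := by
    intro t ht ht1
    have hD := h₁.1 hu hz (sub_nonneg.2 ht1) ht.le (by ring)
    have hg := h₁.2 hu hz (sub_nonneg.2 ht1) ht.le (by ring)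
    have hm := hmin _ hD
    simp only [smul_eq_mul] at hg
    simp only [realH, ← hv] at hm
    have e1 : (1 - t) • u + t • z - x = (u - x) + t • (z - u) := by module
    rw [e1, norm_add_sq_real, inner_add_right, real_inner_smul_right, real_inner_smul_right,
      norm_smul, Real.norm_eq_abs, abs_of_pos ht] at hm
    have e2 : inner ℝ (v + (1 / α) • (u - x)) (z - u) =
        inner ℝ v (z - u) + 2 * (1 / (2 * α)) * inner ℝ (u - x) (z - u) := by
      rw [inner_add_left, real_inner_smul_left]
      congr 2
      field_simp
    rw [e2] at hA
    have : 0 ≤ t * (A + t * (1 / (2 * α) * ‖z - u‖ ^ 2)) := by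
      rw [hA]
      nlinarith
    exact nonneg_of_mul_nonneg_right this ht
  have hlim : Tendsto (fun t : ℝ => A + t * (1 / (2 * α) * ‖z - u‖ ^ 2)) (𝓝[>] 0)
      (𝓝 (A + 0 * (1 / (2 * α) * ‖z - u‖ ^ 2))) :=
    (Continuous.tendsto (by fun_prop) 0).mono_left nhdsWithin_le_nhds
  have hA0 : 0 ≤ A := by
    have := ge_of_tendsto hlim (by
      filter_upwards [Ioc_mem_nhdsGT (zero_lt_one' ℝ)] with t ht using key t ht.1 ht.2)
    simpa using this
  have e : inner ℝ (-v - (1 / α) • (u - x)) (z - u) =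
      -inner ℝ (v + (1 / α) • (u - x)) (z - u) := by
    rw [← inner_neg_left]; congr 1; abel
  rw [e]
  linarith

lemma CompositeSetting.hasGradientAt (hf : CompositeSetting f₀ f₁ L) {x : E}
    (hx : x ∈ closure (dom f₁)) : HasGradientAt f₀ (gradient f₀ x) x := by
  obtain ⟨Ω, hΩ, hsub, hc⟩ := hf.smooth
  exact ((hc.differentiableOn one_ne_zero).differentiableAt
    (hΩ.mem_nhds (hsub hx))).hasGradientAt

/-- The descent lemma on the convex set `dom f₁`. -/
lemma CompositeSetting.descent (hf : CompositeSetting f₀ f₁ L) {x y : E} (hx : x ∈ dom f₁)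
    (hy : y ∈ dom f₁) :
    f₀ y ≤ f₀ x + inner ℝ (gradient f₀ x) (y - x) + L / 2 * ‖y - x‖ ^ 2 := by
  have hconv := (hf.convex.convexOn_toReal hf.proper).1
  have hmem : ∀ t ∈ Set.Icc (0 : ℝ) 1, x + t • (y - x) ∈ dom f₁ := fun t ht =>
    hconv.add_smul_sub_mem hx hy ht
  have hderiv : ∀ t ∈ Set.Icc (0 : ℝ) 1, HasDerivAt
      (fun t : ℝ => f₀ (x + t • (y - x)) - t * inner ℝ (gradient f₀ x) (y - x) -
        L / 2 * ‖y - x‖ ^ 2 * t ^ 2)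
      (inner ℝ (gradient f₀ (x + t • (y - x))) (y - x) - inner ℝ (gradient f₀ x) (y - x) -
        L / 2 * ‖y - x‖ ^ 2 * (2 * t)) t := by
    intro t ht
    have h1 := (hf.hasGradientAt (subset_closure (hmem t ht))).hasFDerivAt
    have h2 : HasDerivAt (fun t : ℝ => x + t • (y - x)) (y - x) t := by
      simpa using ((hasDerivAt_id t).smul_const (y - x)).const_add x
    have h3 := h1.comp_hasDerivAt t h2
    rw [InnerProductSpace.toDual_apply_apply] at h3
    have h4 : HasDerivAt (fun t : ℝ => t * inner ℝ (gradient f₀ x) (y - x))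
        (inner ℝ (gradient f₀ x) (y - x)) t := by
      simpa using (hasDerivAt_id t).mul_const (inner ℝ (gradient f₀ x) (y - x))
    have h5 : HasDerivAt (fun t : ℝ => L / 2 * ‖y - x‖ ^ 2 * t ^ 2)
        (L / 2 * ‖y - x‖ ^ 2 * (2 * t)) t := by
      simpa using (hasDerivAt_pow 2 t).const_mul (L / 2 * ‖y - x‖ ^ 2)
    exact (h3.sub h4).sub h5
  have hanti := antitoneOn_of_deriv_nonpos (convex_Icc (0 : ℝ) 1)
    (fun t ht => (hderiv t ht).continuousAt.continuousWithinAt)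
    (fun t ht => (hderiv t (interior_subset ht)).differentiableAt.differentiableWithinAt)
    (fun t ht => by
      have ht' := interior_subset ht
      rw [(hderiv t ht').deriv, ← inner_sub_left]
      have h1 := real_inner_le_norm (gradient f₀ (x + t • (y - x)) - gradient f₀ x) (y - x)
      have h2 := hf.lipschitz _ (hmem t ht') x hx
      rw [add_sub_cancel_left, norm_smul, Real.norm_eq_abs, abs_of_nonneg ht'.1] at h2
      have h3 := mul_le_mul_of_nonneg_right h2 (norm_nonneg (y - x))
      linarith)
  have := hanti (Set.left_mem_Icc.2 zero_le_one) (Set.right_mem_Icc.2 zero_le_one) zero_le_one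
  simp only [one_smul, zero_smul, add_sub_cancel, add_zero] at this
  linarith

end Prox

/-! ### Bounds in terms of `-Delta` and the line search. -/

section Estimates

set_option linter.unusedSectionVars false

variable {E : Type*} [NormedAddCommGroup E] [InnerProductSpace ℝ E] [CompleteSpace E]
  {f₀ : E → ℝ} {f₁ : E → EReal} {L : ℝ}

/-- The constant that bounds the squared step lengths by `-Delta`. -/
def Params.stepConst (P : Params) : ℝ := 4 * P.αmax * (1 + P.τ) + 1 / P.γmin

lemma Params.αmax_pos (P : Params) : 0 < P.αmax := P.αmin_pos.trans_le P.αmin_le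

lemma Params.stepConst_pos (P : Params) : 0 < P.stepConst := by
  have h1 := P.αmax_pos
  have h2 := P.γmin_pos
  have h3 := P.τ_nonneg
  unfold Params.stepConst
  positivity

lemma Params.ratio_mem (P : Params) {α β : ℝ} (hα : α ∈ Set.Icc P.αmin P.αmax)
    (hβ : β ∈ Set.Icc 0 P.βmax) : β / α ∈ Set.Icc 0 (P.βmax / P.αmin) :=
  ⟨div_nonneg hβ.1 (P.αmin_pos.trans_le hα.1).le,
    div_le_div₀ P.βmax_pos.le hβ.2 P.αmin_pos hα.1⟩

lemma Params.mul_le_stepConst_mul (P : Params) {α H D : ℝ} (hα : α ∈ Set.Icc P.αmin P.αmax)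
    (hH : 0 ≤ H) (hHD : H ≤ D) : 4 * α * ((1 + P.τ) * H) ≤ P.stepConst * D := by
  have h3 := P.τ_nonneg
  have h4 : 4 * α * ((1 + P.τ) * H) ≤ 4 * P.αmax * ((1 + P.τ) * H) := by
    have := hα.2
    gcongr
  have h5 : 4 * P.αmax * (1 + P.τ) * H ≤ P.stepConst * D := by
    refine mul_le_mul ?_ hHD hH P.stepConst_pos.le
    unfold Params.stepConst
    linarith [one_div_pos.2 P.γmin_pos]
  linarith

lemma IsInexactProx.realH_nonpos (hf : CompositeSetting f₀ f₁ L) (P : Params)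
    {α β : ℝ} {x s y : E} (hx : x ∈ dom f₁) (hp : IsInexactProx f₀ f₁ P.τ α β x s y) :
    realH f₀ f₁ α β x s y ≤ 0 := by
  have h := hp.le_realH hf.proper hx hx
  rw [realH_self] at h
  exact nonpos_of_mul_nonpos_right h (by linarith [P.τ_nonneg])

lemma IsInexactProx.norm_bounds (hf : CompositeSetting f₀ f₁ L) (P : Params)
    {α β γ : ℝ} {x s y : E} (hα : α ∈ Set.Icc P.αmin P.αmax) (hγ : γ ∈ Set.Icc P.γmin P.γmax)
    (hx : x ∈ dom f₁) (hp : IsInexactProx f₀ f₁ P.τ α β x s y) :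
    -realH f₀ f₁ α β x s y ≤ -Delta f₀ f₁ α β γ x s y ∧
      ‖y - x‖ ^ 2 ≤ P.stepConst * -Delta f₀ f₁ α β γ x s y ∧
      ‖x - s‖ ^ 2 ≤ P.stepConst * -Delta f₀ f₁ α β γ x s y := by
  have hH := hp.realH_nonpos hf P hx
  have hγ0 : 0 < γ := P.γmin_pos.trans_le hγ.1
  have hα0 : 0 < α := P.αmin_pos.trans_le hα.1
  rw [hf.proper.delta_eq hx hp.1]
  set H := realH f₀ f₁ α β x s y with hHdef
  have hle : -H ≤ -(H - γ * ‖x - s‖ ^ 2) := by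
    have : 0 ≤ γ * ‖x - s‖ ^ 2 := by positivity
    linarith
  refine ⟨hle, ?_, ?_⟩
  · refine le_trans ?_ (P.mul_le_stepConst_mul hα (neg_nonneg.2 hH) hle)
    -- With the lower bound `m = (1 + τ/2) H` and value `0` at `x`, the right side is `4 α (1 + τ)
    -- (-H)`.
    have h := norm_sub_sq_le_of_le_realH (hf.convex.convexOn_toReal hf.proper) hp.1 hx hα0
      (fun z hz => hp.le_realH hf.proper hx hz)
    rw [realH_self, ← hHdef] at h
    refine h.trans (le_of_eq ?_)
    ring
  · have h1 : ‖x - s‖ ^ 2 ≤ 1 / P.γmin * -(H - γ * ‖x - s‖ ^ 2) := by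
      rw [one_div_mul_eq_div, le_div_iff₀ P.γmin_pos]
      nlinarith [mul_le_mul_of_nonneg_right hγ.1 (sq_nonneg ‖x - s‖)]
    refine h1.trans (mul_le_mul_of_nonneg_right ?_ ((neg_nonneg.2 hH).trans hle))
    have := P.αmax_pos
    have := P.τ_nonneg
    unfold Params.stepConst
    linarith [show 0 ≤ 4 * P.αmax * (1 + P.τ) by positivity]

lemma norm_add_sq_le_two_mul (a b : E) : ‖a + b‖ ^ 2 ≤ 2 * ‖a‖ ^ 2 + 2 * ‖b‖ ^ 2 := by
  have := parallelogram_law_with_norm ℝ a b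
  nlinarith [sq_nonneg ‖a - b‖]

/-- Sufficiently short steps satisfy the Armijo inequality. -/
lemma exists_armijo_of_le (hf : CompositeSetting f₀ f₁ L) (P : Params) :
    ∃ B : ℝ, 0 < B ∧ ∀ (α β γ : ℝ) (x s y : E), α ∈ Set.Icc P.αmin P.αmax →
      β ∈ Set.Icc 0 P.βmax → γ ∈ Set.Icc P.γmin P.γmax → x ∈ dom f₁ →
      IsInexactProx f₀ f₁ P.τ α β x s y → ∀ t : ℝ, 0 < t → t ≤ 1 → B * t ≤ 1 - P.σ →
      Armijo f₀ f₁ P.σ α β γ x s y t := by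
  have hL := hf.L_pos
  have hc := P.stepConst_pos
  refine ⟨(L + 2 * (P.βmax / P.αmin) ^ 2 + 2 * P.γmax ^ 2) / 2 * P.stepConst, by positivity, ?_⟩
  intro α β γ x s y hα hβ hγ hx hp t ht ht1 hBt
  obtain ⟨-, hyx, hxs⟩ := hp.norm_bounds hf P hα hγ hx
  have hα0 : 0 < α := P.αmin_pos.trans_le hα.1
  have hΔ := hf.proper.delta_eq (f₀ := f₀) hx hp.1 α β γ s
  obtain ⟨hκ0, hκ⟩ := P.ratio_mem hα hβ
  have hD : 0 ≤ -Delta f₀ f₁ α β γ x s y :=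
    nonneg_of_mul_nonneg_right ((sq_nonneg _).trans hyx) hc
  set D := -Delta f₀ f₁ α β γ x s y with hDdef
  set κ := β / α with hκdef
  have hconv := hf.convex.convexOn_toReal hf.proper
  have hnew : x + t • dirX x y = (1 - t) • x + t • y := by unfold dirX; module
  have hmem : x + t • dirX x y ∈ dom f₁ := by
    rw [hnew]; exact hconv.1 hx hp.1 (sub_nonneg.2 ht1) ht.le (by ring)
  have hg : (f₁ (x + t • dirX x y)).toReal ≤ (1 - t) * (f₁ x).toReal + t * (f₁ y).toReal := by
    rw [hnew]; exact hconv.2 hx hp.1 (sub_nonneg.2 ht1) ht.le (by ring)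
  have hf0 := hf.descent hx hmem
  rw [add_sub_cancel_left, real_inner_smul_right, norm_smul, Real.norm_eq_abs, abs_of_pos ht]
    at hf0
  rw [Armijo, hf.proper.meritPhi_eq_coe hmem, hf.proper.meritPhi_eq_coe hx, ← EReal.coe_add,
    EReal.coe_le_coe_iff]
  -- The component `dirS` is designed so that the cross term of the squared distance reproduces the
  -- inertial term of `h` and the term `-γ‖x - s‖²`, which together make up `Delta`.
  have hdiff : x + t • dirX x y - (s + t • dirS α β γ x s y) =
      (x - s) - t • (κ • (y - x) + γ • (x - s)) := by
    unfold dirX dirS; module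
  have hns : ‖κ • (y - x) + γ • (x - s)‖ ^ 2 ≤
      2 * (P.βmax / P.αmin) ^ 2 * (P.stepConst * D) + 2 * P.γmax ^ 2 * (P.stepConst * D) := by
    have hγ0 : 0 ≤ γ := P.γmin_pos.le.trans hγ.1
    refine (norm_add_sq_le_two_mul _ _).trans ?_
    rw [norm_smul, norm_smul, Real.norm_eq_abs, Real.norm_eq_abs, abs_of_nonneg hκ0,
      abs_of_nonneg hγ0, mul_pow, mul_pow, mul_assoc 2, mul_assoc 2]
    have := hγ.2
    gcongr
  have hdx : dirX x y = y - x := rfl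
  rw [realPhi, realPhi, realObjective, realObjective, hdiff, norm_sub_sq_real,
    real_inner_smul_right, inner_add_right, real_inner_smul_right, real_inner_smul_right,
    real_inner_self_eq_norm_sq, norm_smul, Real.norm_eq_abs, abs_of_pos ht]
  rw [hdx] at hf0 hg ⊢
  rw [realH, inner_sub_left, real_inner_smul_left] at hΔ
  have h1 : 0 ≤ 1 / (2 * α) * ‖y - x‖ ^ 2 := by positivity
  -- The nonnegative proximal term of `h` is discarded here.
  have h2 : t * ((f₁ y).toReal - (f₁ x).toReal + inner ℝ (gradient f₀ x) (y - x)
      - κ * inner ℝ (x - s) (y - x) - γ * ‖x - s‖ ^ 2) ≤ t * -D :=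
    mul_le_mul_of_nonneg_left (by linarith) ht.le
  have h3 : L * ‖y - x‖ ^ 2 + ‖κ • (y - x) + γ • (x - s)‖ ^ 2 ≤
      2 * ((L + 2 * (P.βmax / P.αmin) ^ 2 + 2 * P.γmax ^ 2) / 2 * P.stepConst) * D := by
    linarith [mul_le_mul_of_nonneg_left hyx hL.le]
  have h4 := mul_le_mul_of_nonneg_left h3 (sq_nonneg t)
  have h5 := mul_le_mul_of_nonneg_right hBt (mul_nonneg ht.le hD)
  have h6 : P.σ * t * Delta f₀ f₁ α β γ x s y = -(P.σ * (t * D)) := by rw [hDdef]; ring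
  rw [h6]
  nlinarith

lemma exists_lineSearchReturns (hf : CompositeSetting f₀ f₁ L) (P : Params) :
    ∃ lamMin : ℝ, 0 < lamMin ∧ ∀ (α β γ : ℝ) (x s y : E), α ∈ Set.Icc P.αmin P.αmax →
      β ∈ Set.Icc 0 P.βmax → γ ∈ Set.Icc P.γmin P.γmax → x ∈ dom f₁ →
      IsInexactProx f₀ f₁ P.τ α β x s y →
      ∃ lam : ℝ, LineSearchReturns f₀ f₁ P.σ P.δ α β γ x s y lam ∧ lamMin ≤ lam := by
  obtain ⟨B, hB, h⟩ := exists_armijo_of_le hf P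
  have hσ : 0 < 1 - P.σ := sub_pos.2 P.σ_lt_one
  have hδ := P.δ_pos
  -- Either the first trial succeeds, or the trial just before the accepted one failed and therefore
  -- exceeded `(1 - σ)/B`; the accepted step is `δ` times that one.
  refine ⟨min 1 (P.δ * ((1 - P.σ) / B)), lt_min one_pos (by positivity), ?_⟩
  intro α β γ x s y hα hβ hγ hx hp
  have hA : ∀ j : ℕ, P.δ ^ j ≤ (1 - P.σ) / B → Armijo f₀ f₁ P.σ α β γ x s y (P.δ ^ j) :=
    fun j hj => h α β γ x s y hα hβ hγ hx hp _ (pow_pos hδ j)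
      (pow_le_one₀ hδ.le P.δ_lt_one.le) (by rw [mul_comm]; exact (le_div_iff₀ hB).1 hj)
  have hex : ∃ j : ℕ, Armijo f₀ f₁ P.σ α β γ x s y (P.δ ^ j) := by
    obtain ⟨j, hj⟩ := exists_pow_lt_of_lt_one (show 0 < (1 - P.σ) / B by positivity) P.δ_lt_one
    exact ⟨j, hA j hj.le⟩
  classical
  refine ⟨P.δ ^ Nat.find hex, ⟨Nat.find hex, ⟨Nat.find_spec hex, fun j hj => Nat.find_min' hex hj⟩,
    rfl⟩, ?_⟩
  rcases hm : Nat.find hex with _ | m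
  · simp
  · refine (min_le_right _ _).trans ?_
    have hnot := Nat.find_min hex (m := m) (by omega)
    have : (1 - P.σ) / B ≤ P.δ ^ m := le_of_lt (not_le.1 fun hle => hnot (hA m hle))
    rw [pow_succ']
    exact mul_le_mul_of_nonneg_left this hδ.le

/-- Estimates for the exact inertial proximal gradient point `u` and a subgradient `w` of `f₁` at it,
in terms of `-Delta` at the inexact point `y`. -/
lemma exists_prox_estimates (hf : CompositeSetting f₀ f₁ L) (P : Params) :
    ∃ C : ℝ, 0 < C ∧ ∀ (α β γ : ℝ) (x s y : E), α ∈ Set.Icc P.αmin P.αmax →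
      β ∈ Set.Icc 0 P.βmax → γ ∈ Set.Icc P.γmin P.γmax → x ∈ dom f₁ →
      IsInexactProx f₀ f₁ P.τ α β x s y → 0 ≤ -Delta f₀ f₁ α β γ x s y ∧
      ‖y - x‖ ^ 2 ≤ C * -Delta f₀ f₁ α β γ x s y ∧
      ∃ u ∈ dom f₁, ∃ w : E,
        (∀ z ∈ dom f₁, (f₁ u).toReal + inner ℝ w (z - u) ≤ (f₁ z).toReal) ∧
        ‖u - x‖ ^ 2 ≤ C * -Delta f₀ f₁ α β γ x s y ∧
        ‖gradient f₀ u + w‖ ^ 2 ≤ C * -Delta f₀ f₁ α β γ x s y ∧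
        realPhi f₀ f₁ y x ≤ realObjective f₀ f₁ u + C * -Delta f₀ f₁ α β γ x s y ∧
        realObjective f₀ f₁ u ≤ realObjective f₀ f₁ x + C * -Delta f₀ f₁ α β γ x s y := by
  have hL := hf.L_pos
  have hc := P.stepConst_pos
  have hκpos : 0 < P.βmax / P.αmin := div_pos P.βmax_pos P.αmin_pos
  have hιpos : 0 < 1 / P.αmin := one_div_pos.2 P.αmin_pos
  set c := P.stepConst with hcdef
  set K := P.βmax / P.αmin with hK
  set ι := 1 / P.αmin with hι
  have hτ := P.τ_nonneg
  -- One constant large enough for all the estimates: the last summand serves the subgradient bound,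
  -- the others the distances and function values.
  refine ⟨(1 + P.τ) + (1 + 3 * L + 3 * K + 3 * ι) * c + (L + K + ι) ^ 2 * c, by positivity, ?_⟩
  intro α β γ x s y hα hβ hγ hx hp
  obtain ⟨hHD, hyx, hxs⟩ := hp.norm_bounds hf P hα hγ hx
  have hα0 : 0 < α := P.αmin_pos.trans_le hα.1
  obtain ⟨hκ0, hκ⟩ := P.ratio_mem hα hβ
  have hH := hp.realH_nonpos hf P hx
  have hconv := hf.convex.convexOn_toReal hf.proper
  have hD : 0 ≤ -Delta f₀ f₁ α β γ x s y := (neg_nonneg.2 hH).trans hHD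
  set D := -Delta f₀ f₁ α β γ x s y with hDdef
  set H := realH f₀ f₁ α β x s y with hHdef
  have hmono : ∀ {a b : ℝ}, a ≤ b * D → b ≤ (1 + P.τ) + (1 + 3 * L + 3 * K + 3 * ι) * c +
      (L + K + ι) ^ 2 * c → a ≤ ((1 + P.τ) + (1 + 3 * L + 3 * K + 3 * ι) * c +
      (L + K + ι) ^ 2 * c) * D := fun h1 h2 => h1.trans (mul_le_mul_of_nonneg_right h2 hD)
  have hLc : 0 < L * c := by positivity
  have hKc : 0 < K * c := by positivity
  have hιc : 0 < ι * c := by positivity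
  have hsqc : 0 < (L + K + ι) ^ 2 * c := by positivity
  obtain ⟨u, hu, hmin⟩ := exists_isMinOn_realH hf hα0 (x := x) (s := s) (β := β)
    (fun z hz => hp.le_realH hf.proper hx hz)
  have hlow := hp.le_realH hf.proper hx hu
  rw [← hHdef] at hlow
  have hHu : realH f₀ f₁ α β x s u ≤ 0 := by simpa using hmin x hx
  have hux : ‖u - x‖ ^ 2 ≤ c * D := by
    refine le_trans ?_ (P.mul_le_stepConst_mul hα (neg_nonneg.2 hH) hHD)
    have h := norm_sub_sq_le_of_le_realH hconv hu hx hα0 hmin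
    rw [realH_self] at h
    refine h.trans (mul_le_mul_of_nonneg_left ?_ (by positivity))
    nlinarith
  have hyu : ‖y - u‖ ^ 2 ≤ c * D := by
    refine le_trans ?_ (P.mul_le_stepConst_mul hα (neg_nonneg.2 hH) hHD)
    have h := norm_sub_sq_le_of_le_realH hconv hp.1 hu hα0 hmin
    rw [← hHdef] at h
    refine h.trans (mul_le_mul_of_nonneg_left ?_ (by positivity))
    nlinarith
  have hcD : 0 ≤ c * D := by positivity
  -- products of two of the small norms
  have hprod : ∀ {a b : E}, ‖a‖ ^ 2 ≤ c * D → ‖b‖ ^ 2 ≤ c * D → ‖a‖ * ‖b‖ ≤ c * D :=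
    fun {a b} ha hb => by nlinarith [sq_nonneg (‖a‖ - ‖b‖)]
  have hinner : ∀ {a b : E}, ‖a‖ ^ 2 ≤ c * D → ‖b‖ ^ 2 ≤ c * D →
      β / α * inner ℝ a b ≤ K * (c * D) := fun {a b} ha hb =>
    (mul_le_mul_of_nonneg_left ((real_inner_le_norm a b).trans (hprod ha hb)) hκ0).trans
      (mul_le_mul_of_nonneg_right hκ hcD)
  have hια : 1 / α ≤ ι := one_div_le_one_div_of_le P.αmin_pos hα.1
  refine ⟨hD, hmono hyx (by linarith), u, hu,
    -(gradient f₀ x - (β / α) • (x - s)) - (1 / α) • (u - x),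
    fun z hz => subgradient_of_isMinOn_realH hconv hα0 hu hz hmin, hmono hux (by linarith),
    ?_, ?_, ?_⟩
  · have hn : ‖gradient f₀ u + (-(gradient f₀ x - (β / α) • (x - s)) - (1 / α) • (u - x))‖ ≤
        (L + K + ι) * √(c * D) := by
      have e : gradient f₀ u + (-(gradient f₀ x - (β / α) • (x - s)) - (1 / α) • (u - x)) =
          (gradient f₀ u - gradient f₀ x) + (β / α) • (x - s) - (1 / α) • (u - x) := by abel
      rw [e]
      refine (norm_sub_le _ _).trans ((add_le_add_left (norm_add_le _ _) _).trans ?_)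
      rw [norm_smul, norm_smul, Real.norm_eq_abs, Real.norm_eq_abs, abs_of_nonneg hκ0,
        abs_of_nonneg (one_div_pos.2 hα0).le, add_mul, add_mul]
      have h1 : ‖u - x‖ ≤ √(c * D) := Real.le_sqrt_of_sq_le hux
      have h2 : ‖x - s‖ ≤ √(c * D) := Real.le_sqrt_of_sq_le hxs
      have h3 := (hf.lipschitz u hu x hx).trans (mul_le_mul_of_nonneg_left h1 hL.le)
      gcongr
    refine hmono (b := (L + K + ι) ^ 2 * c)
      ((pow_le_pow_left₀ (norm_nonneg _) hn 2).trans ?_) ?_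
    · rw [mul_pow, Real.sq_sqrt hcD, mul_assoc]
    · have : 0 ≤ (1 + P.τ) + (1 + 3 * L + 3 * K + 3 * ι) * c := by positivity
      linarith
  -- Descent from `u` to `y` produces the gradient at `u`, whereas `h` contains the gradient at `x`;
  -- the exchange costs `L‖u - x‖‖y - u‖`. The remaining difference is the gap `h(y) - h(u)`, at
  -- most `τ/2 * D` by inexactness.
  · have hf0 := hf.descent hu hp.1
    have hgap : H - realH f₀ f₁ α β x s u ≤ P.τ / 2 * D := by nlinarith
    have e : H - realH f₀ f₁ α β x s u = (f₁ y).toReal - (f₁ u).toReal +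
        inner ℝ (gradient f₀ x) (y - u) - β / α * inner ℝ (x - s) (y - u) +
        1 / α * (‖y - x‖ ^ 2 / 2) - 1 / α * (‖u - x‖ ^ 2 / 2) := by
      have e1 : y - x = (y - u) + (u - x) := by abel
      rw [hHdef, realH, realH]
      nth_rewrite 1 [e1]
      rw [inner_add_right, inner_sub_left _ _ (y - u), real_inner_smul_left]
      have : 1 / (2 * α) = 1 / α / 2 := by rw [div_div, mul_comm]
      rw [this]
      ring
    have hin1 : inner ℝ (gradient f₀ u) (y - u) - inner ℝ (gradient f₀ x) (y - u) ≤
        L * (c * D) := by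
      rw [← inner_sub_left]
      refine (real_inner_le_norm _ _).trans ?_
      have := mul_le_mul_of_nonneg_right (hf.lipschitz u hu x hx) (norm_nonneg (y - u))
      rw [mul_assoc] at this
      exact this.trans (mul_le_mul_of_nonneg_left (hprod hux hyu) hL.le)
    have hin2 := hinner hxs hyu
    have hin3 : 1 / α * (‖u - x‖ ^ 2 / 2) ≤ ι * (c * D) :=
      mul_le_mul hια (by linarith [sq_nonneg ‖u - x‖]) (by positivity) hιpos.le
    have hin4 : 0 ≤ 1 / α * (‖y - x‖ ^ 2 / 2) := by positivity
    have hin5 : L / 2 * ‖y - u‖ ^ 2 ≤ L / 2 * (c * D) :=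
      mul_le_mul_of_nonneg_left hyu (by positivity)
    rw [realPhi, realObjective, realObjective]
    have htot : f₀ y + (f₁ y).toReal + ‖y - x‖ ^ 2 / 2 - (f₀ u + (f₁ u).toReal) ≤
        (P.τ / 2 + (1 / 2 + 3 / 2 * L + K + ι) * c) * D := by linarith
    have := hmono htot (by linarith)
    linarith
  · have hf0 := hf.descent hx hu
    have hin2 := hinner hxs hux
    have hin4 : 0 ≤ 1 / (2 * α) * ‖u - x‖ ^ 2 := by positivity
    have hin5 : L / 2 * ‖u - x‖ ^ 2 ≤ L / 2 * (c * D) :=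
      mul_le_mul_of_nonneg_left hux (by positivity)
    rw [realH, inner_sub_left, real_inner_smul_left] at hHu
    rw [realObjective, realObjective]
    have htot : f₀ u + (f₁ u).toReal - (f₀ x + (f₁ x).toReal) ≤ (L / 2 * c + K * c) * D := by
      linarith
    have := hmono htot (by linarith)
    linarith

end Estimates

/-! ### Subgradients of the objective and of the KL function. -/

section Subdifferential

set_option linter.unusedSectionVars false

variable {E : Type*} [NormedAddCommGroup E] [InnerProductSpace ℝ E] [CompleteSpace E]
  {f₀ : E → ℝ} {f₁ : E → EReal} {L : ℝ}

lemma objective_eq_top {z : E} (hz : z ∉ dom f₁) : objective f₀ f₁ z = ⊤ := by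
  have : f₁ z = ⊤ := not_lt_top_iff.1 hz
  rw [objective, this, EReal.coe_add_top]

lemma CompositeSetting.isLittleO (hf : CompositeSetting f₀ f₁ L) {u : E} (hu : u ∈ dom f₁) :
    (fun z => f₀ z - f₀ u - inner ℝ (gradient f₀ u) (z - u)) =o[𝓝 u] fun z => z - u :=
  (hf.hasGradientAt (subset_closure hu)).hasFDerivAt.isLittleO

/-- The sum of the gradient of `f₀` and of a convex subgradient of `f₁` is a subgradient of
`f₀ + f₁`. -/
lemma CompositeSetting.mem_frechetSubdiff_objective (hf : CompositeSetting f₀ f₁ L) {u w : E}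
    (hu : u ∈ dom f₁)
    (hw : ∀ z ∈ dom f₁, (f₁ u).toReal + inner ℝ w (z - u) ≤ (f₁ z).toReal) :
    gradient f₀ u + w ∈ frechetSubdiff (objective f₀ f₁) u := by
  refine mem_frechetSubdiff_of_isLittleO (hf.proper.objective_eq_coe hu) (hf.isLittleO hu) ?_
  intro z
  by_cases hz : z ∈ dom f₁
  · rw [hf.proper.objective_eq_coe hz, EReal.coe_le_coe_iff, inner_add_left]
    simp only [realObjective]
    linarith [hw z hz]
  · rw [objective_eq_top hz]
    exact le_top

lemma IsProper.meritF_eq_coe (h₁ : IsProper f₁) {u : E} (hu : u ∈ dom f₁) (ρ : ℝ) :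
    meritF (objective f₀ f₁) (WithLp.toLp 2 (u, ρ)) =
      ((realObjective f₀ f₁ u + ρ ^ 2 / 2 : ℝ) : EReal) := by
  rw [EReal.coe_add, ← h₁.objective_eq_coe hu]
  rfl

lemma CompositeSetting.mem_frechetSubdiff_meritF (hf : CompositeSetting f₀ f₁ L) {u w : E}
    (hu : u ∈ dom f₁)
    (hw : ∀ z ∈ dom f₁, (f₁ u).toReal + inner ℝ w (z - u) ≤ (f₁ z).toReal) (ρ : ℝ) :
    WithLp.toLp 2 (gradient f₀ u + w, ρ) ∈
      frechetSubdiff (meritF (objective f₀ f₁)) (WithLp.toLp 2 (u, ρ)) := by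
  have ho : (fun z : WithLp 2 (E × ℝ) =>
      f₀ z.fst - f₀ u - inner ℝ (gradient f₀ u) (z.fst - u)) =o[𝓝 (WithLp.toLp 2 (u, ρ))]
      fun z => z - WithLp.toLp 2 (u, ρ) := by
    have hcont : Continuous fun z : WithLp 2 (E × ℝ) => z.fst := by fun_prop
    have h1 := (hf.isLittleO hu).comp_tendsto (hcont.tendsto (WithLp.toLp 2 (u, ρ)))
    refine h1.trans_isBigO (Asymptotics.IsBigO.of_bound 1 (Eventually.of_forall fun z => ?_))
    have h2 := WithLp.prod_norm_sq_eq_of_L2 (z - WithLp.toLp 2 (u, ρ))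
    rw [one_mul, ← pow_le_pow_iff_left₀ (norm_nonneg _) (norm_nonneg _) two_ne_zero, h2]
    exact le_add_of_nonneg_right (sq_nonneg _)
  refine mem_frechetSubdiff_of_isLittleO (hf.proper.meritF_eq_coe hu ρ) ho ?_
  intro z
  by_cases hz : z.fst ∈ dom f₁
  · rw [show z = WithLp.toLp 2 (z.fst, z.snd) from rfl, hf.proper.meritF_eq_coe hz,
      EReal.coe_le_coe_iff, WithLp.prod_inner_apply]
    simp only [realObjective, WithLp.toLp_fst, inner_add_left, WithLp.ofLp_sub, Prod.fst_sub, Prod.snd_sub, RCLike.inner_apply, conj_trivial]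
    -- The remainder of the scalar square is `(z.snd - ρ)²/2 ≥ 0`, so only the remainder of `f₀` has
    -- to be small.
    nlinarith [hw z.fst hz, sq_nonneg (z.snd - ρ)]
  · rw [meritF, objective_eq_top hz, EReal.top_add_coe]
    exact le_top

end Subdifferential

/-! ### Invariants and merit decrease along a run. -/

section Run

variable {E : Type*} [NormedAddCommGroup E] [InnerProductSpace ℝ E] [CompleteSpace E]
  {f₀ : E → ℝ} {f₁ : E → EReal} {L : ℝ} {P : Params} {α β γ lam : ℕ → ℝ} {x s y : ℕ → E}

lemma LineSearchReturns.unique {σ δ α β γ : ℝ} {x s y : E} {l₁ l₂ : ℝ}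
    (h₁ : LineSearchReturns f₀ f₁ σ δ α β γ x s y l₁)
    (h₂ : LineSearchReturns f₀ f₁ σ δ α β γ x s y l₂) : l₁ = l₂ := by
  obtain ⟨m₁, hm₁, rfl⟩ := h₁
  obtain ⟨m₂, hm₂, rfl⟩ := h₂
  rw [hm₁.unique hm₂]

lemma IsRun.lam_mem (h : IsRun f₀ f₁ P α β γ lam x s y) (k : ℕ) : 0 < lam k ∧ lam k ≤ 1 := by
  obtain ⟨m, -, hm⟩ := h.lineSearch k
  rw [hm]
  exact ⟨pow_pos P.δ_pos m, pow_le_one₀ P.δ_pos.le P.δ_lt_one.le⟩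

lemma IsRun.mem_dom (hf : CompositeSetting f₀ f₁ L) (h : IsRun f₀ f₁ P α β γ lam x s y) (k : ℕ) :
    x k ∈ dom f₁ := by
  induction k with
  | zero => exact h.init
  | succ k ih =>
    by_cases hacc : Accepts f₀ f₁ P.σ (α k) (β k) (γ k) (x k) (s k) (y k) (lam k)
    · rw [(h.step_accept k hacc).1]
      exact (h.prox k).1
    · rw [(h.step_reject k hacc).1]
      obtain ⟨h0, h1⟩ := h.lam_mem k
      exact (hf.convex.convexOn_toReal hf.proper).1.add_smul_sub_mem ih (h.prox k).1 ⟨h0.le, h1⟩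

lemma IsRun.norm_sub_le (h : IsRun f₀ f₁ P α β γ lam x s y) (k : ℕ) :
    ‖x (k + 1) - x k‖ ≤ ‖y k - x k‖ := by
  by_cases hacc : Accepts f₀ f₁ P.σ (α k) (β k) (γ k) (x k) (s k) (y k) (lam k)
  · rw [(h.step_accept k hacc).1]
  · obtain ⟨h0, h1⟩ := h.lam_mem k
    rw [(h.step_reject k hacc).1, add_sub_cancel_left, norm_smul, Real.norm_eq_abs, abs_of_pos h0]
    exact mul_le_of_le_one_left (norm_nonneg _) h1

/-- The second bound is an equality for an accepted point. For a rejected one, the Armijo step lies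
below the very threshold that the merit value at `(y k, x k)` exceeds. -/
lemma IsRun.realPhi_succ_le (hf : CompositeSetting f₀ f₁ L) (h : IsRun f₀ f₁ P α β γ lam x s y)
    (k : ℕ) :
    realPhi f₀ f₁ (x (k + 1)) (s (k + 1)) ≤ realPhi f₀ f₁ (x k) (s k) +
        P.σ * lam k * Delta f₀ f₁ (α k) (β k) (γ k) (x k) (s k) (y k) ∧
      realPhi f₀ f₁ (x (k + 1)) (s (k + 1)) ≤ realPhi f₀ f₁ (y k) (x k) := by
  have hx := h.mem_dom hf k
  have hx' := h.mem_dom hf (k + 1)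
  by_cases hacc : Accepts f₀ f₁ P.σ (α k) (β k) (γ k) (x k) (s k) (y k) (lam k)
  · obtain ⟨e1, e2⟩ := h.step_accept k hacc
    rw [Accepts, hf.proper.meritPhi_eq_coe (h.prox k).1, hf.proper.meritPhi_eq_coe hx,
      ← EReal.coe_add, EReal.coe_le_coe_iff] at hacc
    rw [e1, e2]
    exact ⟨hacc, le_rfl⟩
  · obtain ⟨e1, e2⟩ := h.step_reject k hacc
    obtain ⟨m, hm, hlam⟩ := h.lineSearch k
    have harm : Armijo f₀ f₁ P.σ (α k) (β k) (γ k) (x k) (s k) (y k) (P.δ ^ m) := hm.1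
    rw [← hlam, Armijo, ← e1, ← e2, hf.proper.meritPhi_eq_coe hx',
      hf.proper.meritPhi_eq_coe hx, ← EReal.coe_add, EReal.coe_le_coe_iff] at harm
    rw [Accepts, hf.proper.meritPhi_eq_coe (h.prox k).1, hf.proper.meritPhi_eq_coe hx,
      ← EReal.coe_add, EReal.coe_le_coe_iff, not_le] at hacc
    exact ⟨harm, harm.trans hacc.le⟩

/-- The sufficient decrease of the merit function along a run. -/
lemma IsRun.exists_decrease (hf : CompositeSetting f₀ f₁ L)
    (h : IsRun f₀ f₁ P α β γ lam x s y) (hΔ : ∀ k,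
      0 ≤ -Delta f₀ f₁ (α k) (β k) (γ k) (x k) (s k) (y k)) :
    ∃ c : ℝ, 0 < c ∧ ∀ k, realPhi f₀ f₁ (x (k + 1)) (s (k + 1)) +
      c * -Delta f₀ f₁ (α k) (β k) (γ k) (x k) (s k) (y k) ≤ realPhi f₀ f₁ (x k) (s k) := by
  obtain ⟨lmin, hl0, hl⟩ := exists_lineSearchReturns hf P
  refine ⟨P.σ * lmin, mul_pos P.σ_pos hl0, fun k => ?_⟩
  obtain ⟨l, hl1, hl2⟩ := hl _ _ _ _ _ _ (h.α_mem k) (h.β_mem k) (h.γ_mem k) (h.mem_dom hf k)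
    (h.prox k)
  rw [← (h.lineSearch k).unique hl1] at hl2
  have h1 := (h.realPhi_succ_le hf k).1
  have h2 := mul_le_mul_of_nonneg_right (mul_le_mul_of_nonneg_left hl2 P.σ_pos.le) (hΔ k)
  linarith

lemma CompositeSetting.exists_le_realPhi (hf : CompositeSetting f₀ f₁ L) :
    ∃ m : ℝ, ∀ x ∈ dom f₁, ∀ s, m ≤ realPhi f₀ f₁ x s := by
  obtain ⟨m, hm⟩ := hf.bddBelow
  refine ⟨m, fun x hx s => ?_⟩
  have h := hm x
  rw [hf.proper.objective_eq_coe hx, EReal.coe_le_coe_iff] at h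
  rw [realPhi]
  linarith [sq_nonneg ‖x - s‖]

end Run

/-! ### Stationarity of cluster points and the KL argument. -/

section Convergence

set_option linter.unusedSectionVars false

variable {E : Type*} [NormedAddCommGroup E] [InnerProductSpace ℝ E] [CompleteSpace E]
  {f₀ : E → ℝ} {f₁ : E → EReal} {L : ℝ} {P : Params} {α β γ lam : ℕ → ℝ} {x s y : ℕ → E}

lemma coe_lt_coe_add_of_coe_sub_lt {a b : ℝ} {υ : EReal} (h : ((a - b : ℝ) : EReal) < υ) :
    (a : EReal) < b + υ := by
  induction υ with
  | bot => exact absurd h not_lt_bot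
  | top => rw [EReal.coe_add_top]; exact EReal.coe_lt_top a
  | coe r =>
    have h' := EReal.coe_lt_coe_iff.1 h
    rw [← EReal.coe_add, EReal.coe_lt_coe_iff]
    linarith

lemma norm_toLp_prod_le (a : E) (r : ℝ) : ‖WithLp.toLp 2 (a, r)‖ ≤ ‖a‖ + |r| := by
  rw [← pow_le_pow_iff_left₀ (norm_nonneg _) (by positivity) two_ne_zero,
    WithLp.prod_norm_sq_eq_of_L2]
  simp only [WithLp.toLp_fst, WithLp.toLp_snd, Real.norm_eq_abs]
  nlinarith [norm_nonneg a, abs_nonneg r, mul_nonneg (norm_nonneg a) (abs_nonneg r)]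

lemma tendsto_zero_of_norm_sq_le {a : ℕ → E} {b : ℕ → ℝ} (hb : Tendsto b atTop (𝓝 0))
    (h : ∀ k, ‖a k‖ ^ 2 ≤ b k) : Tendsto a atTop (𝓝 0) := by
  refine squeeze_zero_norm (a := fun k => √(b k)) (fun k => Real.le_sqrt_of_sq_le (h k)) ?_
  simpa using hb.sqrt

/-- At the limit of points `x k` carrying nearby points `u k` with subgradients `w k` of `f₁` such
that `∇ f₀ (u k) + w k → 0`, the objective takes the limiting merit value and `-∇ f₀` is a subgradient
of `f₁`. -/
lemma CompositeSetting.optimality_of_tendsto (hf : CompositeSetting f₀ f₁ L) {x u w : ℕ → E} {a : E}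
    {Φ Ψ ε : ℕ → ℝ} {l : ℝ} (hxD : ∀ k, x k ∈ dom f₁) (hx : Tendsto x atTop (𝓝 a))
    (huD : ∀ k, u k ∈ dom f₁) (hu : Tendsto u atTop (𝓝 a))
    (hw : ∀ k, ∀ z ∈ dom f₁, (f₁ (u k)).toReal + inner ℝ (w k) (z - u k) ≤ (f₁ z).toReal)
    (hgw : Tendsto (fun k => gradient f₀ (u k) + w k) atTop (𝓝 0))
    (hΦ : Tendsto Φ atTop (𝓝 l)) (hxΦ : ∀ k, realObjective f₀ f₁ (x k) ≤ Φ k)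
    (hΨ : Tendsto Ψ atTop (𝓝 l)) (hε : Tendsto ε atTop (𝓝 0))
    (huΨ : ∀ k, Ψ k ≤ realObjective f₀ f₁ (u k) + ε k) :
    a ∈ dom f₁ ∧ realObjective f₀ f₁ a = l ∧
      ∀ z ∈ dom f₁, (f₁ a).toReal + inner ℝ (-gradient f₀ a) (z - a) ≤ (f₁ z).toReal := by
  have hcl : a ∈ closure (dom f₁) := mem_closure_of_tendsto hx (Eventually.of_forall hxD)
  have hcont : ContinuousAt f₀ a := (hf.hasGradientAt hcl).hasFDerivAt.continuousAt
  have hle : f₁ a ≤ ((l - f₀ a : ℝ) : EReal) :=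
    le_coe_of_tendsto hf.lsc hx (hΦ.sub (hcont.tendsto.comp hx)) fun k => by
      rw [← hf.proper.coe_toReal (hxD k), EReal.coe_le_coe_iff]
      have := hxΦ k
      simp only [realObjective, Function.comp_apply] at this ⊢
      linarith
  have ha : a ∈ dom f₁ := mem_dom_of_le_coe hle
  have hgrad : Tendsto (fun k => gradient f₀ (u k)) atTop (𝓝 (gradient f₀ a)) := by
    rw [tendsto_iff_norm_sub_tendsto_zero] at hu ⊢
    refine squeeze_zero (fun k => norm_nonneg _) (fun k => hf.lipschitz _ (huD k) _ ha) ?_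
    simpa using hu.const_mul L
  have hwlim : Tendsto w atTop (𝓝 (-gradient f₀ a)) := by
    simpa using hgw.sub hgrad
  have hinner : ∀ z, Tendsto (fun k => inner ℝ (w k) (z - u k)) atTop
      (𝓝 (inner ℝ (-gradient f₀ a) (z - a))) := fun z =>
    hwlim.inner (tendsto_const_nhds.sub hu)
  refine ⟨ha, le_antisymm ?_ ?_, fun z hz => ?_⟩
  · have := hf.proper.toReal_le hle
    rw [realObjective]
    linarith
  -- Lower semicontinuity gives only one inequality. For the other, the subgradient inequality at `u
  -- k` is tested at `a`, bounding `f₁ (u k)` from above without continuity of `f₁`.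
  · have hlim := (((hcont.tendsto.comp hu).add_const (f₁ a).toReal).sub (hinner a)).add hε
    rw [sub_self, inner_zero_right, sub_zero, add_zero] at hlim
    refine le_of_tendsto_of_tendsto' hΨ hlim fun k => (huΨ k).trans ?_
    simp only [realObjective, Function.comp_apply]
    linarith [hw k a ha]
  · have h := le_coe_of_tendsto hf.lsc hu ((hinner z).const_sub (f₁ z).toReal) fun k => by
      rw [← hf.proper.coe_toReal (huD k), EReal.coe_le_coe_iff]
      linarith [hw k z hz]
    linarith [hf.proper.toReal_le h]

/-- The recursion on the step lengths produced by one use of the desingularizing function. -/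
lemma two_mul_le_of_desingularizing {υ : EReal} {φ : ℝ → ℝ} (hφ : IsDesingularizing υ φ)
    {t₁ t₂ t c b d d' : ℝ} (hc : 0 < c) (hb : 0 ≤ b) (hd : 0 ≤ d)
    (h₀ : 0 ≤ t₁) (h₁₂ : t₁ + c * d' ^ 2 ≤ t₂) (h₂ : t₂ ≤ t) (ht : 0 < t)
    (htυ : (t : EReal) < υ) (hKL : 1 ≤ deriv φ t * (b * d)) :
    2 * d' ≤ d + b / c * φ t₂ - b / c * φ t₁ := by
  have hcd : 0 ≤ c * d' ^ 2 := by positivity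
  have hslope := hφ.deriv_mul_sub_le h₀ (by linarith) h₂ ht htυ
  have hpos := hφ.deriv_pos t ht htυ
  have h1 : deriv φ t * (c * d' ^ 2) ≤ φ t₂ - φ t₁ :=
    (mul_le_mul_of_nonneg_left (by linarith) hpos.le).trans hslope
  have hδ : 0 ≤ φ t₂ - φ t₁ := (by positivity : 0 ≤ deriv φ t * (c * d' ^ 2)).trans h1
  have h2 : c * d' ^ 2 ≤ b * d * (φ t₂ - φ t₁) := by
    have h3 := mul_le_mul_of_nonneg_right hKL hcd
    have h4 := mul_le_mul_of_nonneg_left h1 (mul_nonneg hb hd)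
    linarith
  have h5 : d' ^ 2 ≤ d * (b / c * (φ t₂ - φ t₁)) := by
    have : d * (b / c * (φ t₂ - φ t₁)) = b * d * (φ t₂ - φ t₁) / c := by ring
    rw [this, le_div_iff₀ hc]
    linarith
  have h6 : 0 ≤ b / c * (φ t₂ - φ t₁) := by positivity
  have h7 : 2 * d' ≤ d + b / c * (φ t₂ - φ t₁) := by
    refine le_of_abs_le (abs_le_of_sq_le_sq ?_ (by positivity))
    nlinarith [sq_nonneg (d - b / c * (φ t₂ - φ t₁))]
  linarith

theorem IsRun.exists_tendsto_isStationary [ProperSpace E] (hf : CompositeSetting f₀ f₁ L)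
    (hKL : IsKLFunction (meritF (objective f₀ f₁))) (h : IsRun f₀ f₁ P α β γ lam x s y)
    (hbdd : Bornology.IsBounded (Set.range x)) :
    ∃ a : E, Tendsto x atTop (𝓝 a) ∧ IsStationary (objective f₀ f₁) a := by
  obtain ⟨C, hC, hest⟩ := exists_prox_estimates hf P
  have hxD := h.mem_dom hf
  have hest' := fun k => hest (α k) (β k) (γ k) (x k) (s k) (y k) (h.α_mem k) (h.β_mem k)
    (h.γ_mem k) (hxD k) (h.prox k)
  obtain ⟨c, hc, hdec⟩ := h.exists_decrease hf fun k => (hest' k).1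
  have hPhiY := fun k => (h.realPhi_succ_le hf k).2
  set D : ℕ → ℝ := fun k => -Delta f₀ f₁ (α k) (β k) (γ k) (x k) (s k) (y k) with hDdef
  set Φ : ℕ → ℝ := fun k => realPhi f₀ f₁ (x k) (s k) with hΦdef
  have hD0 : ∀ k, 0 ≤ D k := fun k => (hest' k).1
  have hyx : ∀ k, ‖y k - x k‖ ^ 2 ≤ C * D k := fun k => (hest' k).2.1
  choose u huD w hw hux hgw hPhiU hUx using fun k => (hest' k).2.2
  replace hdec : ∀ k, Φ (k + 1) + c * D k ≤ Φ k := hdec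
  -- the merit values decrease to a limit
  have hanti : Antitone Φ := antitone_nat_of_succ_le fun k => by
    linarith [hdec k, mul_nonneg hc.le (hD0 k)]
  obtain ⟨m, hm⟩ := hf.exists_le_realPhi
  have hbelow : BddBelow (Set.range Φ) := ⟨m, by rintro _ ⟨k, rfl⟩; exact hm _ (hxD k) _⟩
  set l := ⨅ k, Φ k
  have hΦl : Tendsto Φ atTop (𝓝 l) := tendsto_atTop_ciInf hanti hbelow
  have hlΦ : ∀ k, l ≤ Φ k := fun k => ciInf_le hbelow k
  have hΦl' : Tendsto (fun k => Φ (k + 1)) atTop (𝓝 l) := (tendsto_add_atTop_iff_nat 1).2 hΦl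
  have hDlim : Tendsto D atTop (𝓝 0) := by
    have h1 : Tendsto (fun k => (Φ k - Φ (k + 1)) / c) atTop (𝓝 0) := by
      simpa using (hΦl.sub hΦl').div_const c
    refine squeeze_zero hD0 (fun k => ?_) h1
    rw [le_div_iff₀ hc]
    linarith [hdec k]
  have hCD : Tendsto (fun k => C * D k) atTop (𝓝 0) := by simpa using hDlim.const_mul C
  have hux0 : Tendsto (fun k => u k - x k) atTop (𝓝 0) := tendsto_zero_of_norm_sq_le hCD hux
  have hgw0 : Tendsto (fun k => gradient f₀ (u k) + w k) atTop (𝓝 0) :=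
    tendsto_zero_of_norm_sq_le hCD hgw
  -- a cluster point is stationary
  obtain ⟨a, -, θ, hθ, hxa⟩ := tendsto_subseq_of_bounded hbdd (Set.mem_range_self (f := x))
  have hθ' := hθ.tendsto_atTop
  have hua : Tendsto (u ∘ θ) atTop (𝓝 a) := by
    have := (hux0.comp hθ').add hxa
    simpa [Function.comp_def] using this
  obtain ⟨ha, hal, hsub⟩ := hf.optimality_of_tendsto (fun k => hxD (θ k)) hxa
    (fun k => huD (θ k)) hua (fun k => hw (θ k)) (hgw0.comp hθ') (hΦl.comp hθ')
    (fun k => by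
      simp only [Function.comp_apply, hΦdef, realPhi]
      linarith [sq_nonneg ‖x (θ k) - s (θ k)‖])
    (hΦl'.comp hθ') (hCD.comp hθ')
    (fun k => (hPhiY (θ k)).trans (hPhiU (θ k)))
  refine ⟨a, ?_, by
    have := hf.mem_frechetSubdiff_objective ha hsub
    rw [add_neg_cancel] at this
    exact frechetSubdiff_subset_limitingSubdiff _ _ this⟩
  -- the Kurdyka–Łojasiewicz inequality at the cluster point
  obtain ⟨υ, U, φ, hυ, hU, hφ, hineq⟩ := hKL (WithLp.toLp 2 (a, 0))
    ⟨_, frechetSubdiff_subset_limitingSubdiff _ _ (hf.mem_frechetSubdiff_meritF ha hsub 0)⟩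
  have hFa : meritF (objective f₀ f₁) (WithLp.toLp 2 (a, 0)) = (l : EReal) := by
    rw [hf.proper.meritF_eq_coe ha, hal]
    norm_num
  -- Chosen so that `ρ k ^ 2 / 2` is exactly the error `C * D k`, which lifts the KL function at `(u
  -- k, ρ k)` above `Φ (k + 1)`.
  set ρ : ℕ → ℝ := fun k => √(2 * (C * D k)) with hρdef
  have hρsq : ∀ k, ρ k ^ 2 = 2 * (C * D k) := fun k =>
    Real.sq_sqrt (mul_nonneg two_pos.le (mul_nonneg hC.le (hD0 k)))
  set W : ℕ → ℝ := fun k => realObjective f₀ f₁ (u k) + C * D k with hWdef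
  have hFu : ∀ k, meritF (objective f₀ f₁) (WithLp.toLp 2 (u k, ρ k)) = (W k : EReal) := fun k => by
    rw [hf.proper.meritF_eq_coe (huD k), hρsq, hWdef]
    congr 2
    ring
  have hΦW : ∀ k, Φ (k + 1) ≤ W k := fun k => (hPhiY k).trans (hPhiU k)
  have hρ0 : Tendsto ρ atTop (𝓝 0) := by
    have := (hCD.const_mul 2).sqrt
    rwa [mul_zero, Real.sqrt_zero] at this
  have hv0 : Tendsto (fun k => Φ k - l) atTop (𝓝 0) := by
    simpa using hΦl.sub_const l
  have hWl : Tendsto (fun k => W k - l) atTop (𝓝 0) := by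
    refine tendsto_of_tendsto_of_tendsto_of_le_of_le (g := fun k => Φ (k + 1) - l)
      (h := fun k => (Φ k - l) + 2 * (C * D k)) (by simpa using hΦl'.sub_const l)
      (by simpa using hv0.add (hCD.const_mul 2)) (fun k => sub_le_sub_right (hΦW k) l) fun k => ?_
    have h1 := hUx k
    simp only [hWdef, hΦdef, realPhi]
    linarith [sq_nonneg ‖x k - s k‖]
  have hlt : ∀ {q : ℕ → ℝ}, Tendsto q atTop (𝓝 0) → ∀ᶠ k in atTop, (q k : EReal) < υ :=
    fun hq => ((continuous_coe_real_ereal.tendsto 0).comp hq).eventually_lt_const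
      (by simpa using hυ)
  obtain ⟨ε, hε, hball⟩ := Metric.mem_nhds_iff.1 hU
  have hclose : ∀ᶠ k in atTop, ‖u k - x k‖ + |ρ k| < ε / 2 := by
    have : Tendsto (fun k => ‖u k - x k‖ + |ρ k|) atTop (𝓝 0) := by
      simpa using hux0.norm.add hρ0.abs
    exact this.eventually_lt_const (half_pos hε)
  obtain ⟨K, hK⟩ := eventually_atTop.1 ((hlt hv0).and ((hlt hWl).and hclose))
  -- The squared subgradient norm is at most `C * D k` from the first component plus `2 * C * D k`
  -- from `ρ k ^ 2`.
  set b := √(3 * C) with hbdef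
  have hb0 : 0 ≤ b := Real.sqrt_nonneg _
  have hbc : 0 ≤ b / c := div_nonneg hb0 hc.le
  have hdsq : ∀ k, √(D k) ^ 2 = D k := fun k => Real.sq_sqrt (hD0 k)
  refine tendsto_of_localized_recursion (d := fun k => √(D k))
    (ψ := fun k => b / c * φ (Φ k - l)) (p := √C) (r := ε / 2) (K := K) (half_pos hε)
    (Real.sqrt_nonneg _) (fun k => Real.sqrt_nonneg _)
    (fun k hk => mul_nonneg hbc (hφ.nonneg _ (sub_nonneg.2 (hlΦ k)) (hK k hk).1))
    (by simpa using hDlim.sqrt) ?_ ?_ (MapClusterPt.of_comp hθ' hxa.mapClusterPt) ?_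
  · have hφc : Tendsto φ (𝓝[{t : ℝ | 0 ≤ t ∧ (t : EReal) < υ}] 0) (𝓝 (φ 0)) :=
      hφ.continuousOn 0 ⟨le_rfl, by simpa using hυ⟩
    have := hφc.comp (tendsto_nhdsWithin_iff.2 ⟨hv0, by
      filter_upwards [hlt hv0] with k hk using ⟨sub_nonneg.2 (hlΦ k), hk⟩⟩)
    rw [hφ.map_zero] at this
    simpa using this.const_mul (b / c)
  · intro k
    rw [dist_comm, dist_eq_norm, ← Real.sqrt_mul hC.le]
    exact (h.norm_sub_le k).trans (Real.le_sqrt_of_sq_le (hyx k))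
  · intro k hk hka
    obtain ⟨-, hWυ, hcl⟩ := hK k hk
    have hdec1 : Φ (k + 2) + c * D (k + 1) ≤ Φ (k + 1) := hdec (k + 1)
    rcases (hlΦ (k + 1)).eq_or_lt with heq | hgt
    -- If the merit limit is already attained, the next decrease vanishes and the recursion is
    -- trivial; otherwise `W k` is strictly above `l`, as the KL inequality requires.
    · have h2 : Φ (k + 2) = Φ (k + 1) := le_antisymm (hanti (by omega)) (heq ▸ hlΦ (k + 2))
      have h3 : D (k + 1) = 0 := by
        refine le_antisymm ?_ (hD0 _)
        rw [h2] at hdec1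
        exact nonpos_of_mul_nonpos_right (by linarith) hc
      simp only [h2, h3, Real.sqrt_zero]
      linarith [Real.sqrt_nonneg (D k)]
    have hmem : WithLp.toLp 2 (u k, ρ k) ∈ U := by
      refine hball ?_
      rw [Metric.mem_ball, dist_eq_norm, ← WithLp.toLp_sub, Prod.mk_sub_mk, sub_zero]
      refine (norm_toLp_prod_le _ _).trans_lt ?_
      have h1 := norm_sub_le_norm_sub_add_norm_sub (u k) (x k) a
      rw [dist_eq_norm] at hka
      linarith
    have hlW : l < W k := hgt.trans_le (hΦW k)
    have hkl := hineq _ hmem (by rw [hFa, hFu]; exact EReal.coe_lt_coe_iff.2 hlW)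
      (by rw [hFa, hFu]; exact coe_lt_coe_add_of_coe_sub_lt hWυ)
    rw [hFa, hFu, ← EReal.coe_sub, EReal.toReal_coe] at hkl
    have hnorm : ‖WithLp.toLp 2 (gradient f₀ (u k) + w k, ρ k)‖ ≤ b * √(D k) := by
      rw [hbdef, ← Real.sqrt_mul (by positivity)]
      refine Real.le_sqrt_of_sq_le ?_
      rw [WithLp.prod_norm_sq_eq_of_L2]
      simp only [WithLp.toLp_fst, WithLp.toLp_snd, Real.norm_eq_abs, sq_abs]
      linarith [hρsq k, hgw k]
    have hpos := hφ.deriv_pos (W k - l) (sub_pos.2 hlW) hWυ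
    have hone := one_le_deriv_mul_of_mem_limitingSubdiff hkl
      (frechetSubdiff_subset_limitingSubdiff _ _
        (hf.mem_frechetSubdiff_meritF (huD k) (hw k) (ρ k))) hnorm hpos.le
    -- The levels are `Φ (k + 2) ≤ Φ (k + 1) ≤ W k`, shifted by `l`: the subgradient from iteration
    -- `k` controls the decrease of iteration `k + 1`.
    exact two_mul_le_of_desingularizing hφ hc hb0 (Real.sqrt_nonneg _)
      (sub_nonneg.2 (hlΦ (k + 2))) (by rw [hdsq]; linarith) (sub_le_sub_right (hΦW k) l)
      (sub_pos.2 hlW) hWυ hone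

end Convergence

end IPila

end

theorem theorem4p2 (n : ℕ) (f₀ : EuclideanSpace ℝ (Fin n) → ℝ)
    (f₁ : EuclideanSpace ℝ (Fin n) → EReal) (L : ℝ)
    (hf : IPila.CompositeSetting f₀ f₁ L) (P : IPila.Params) :
    -- the line search terminates, with a uniform lower bound on the returned step
    (∃ lamMin : ℝ, 0 < lamMin ∧
      ∀ (α β γ : ℝ) (x s y : EuclideanSpace ℝ (Fin n)),
        α ∈ Set.Icc P.αmin P.αmax → β ∈ Set.Icc 0 P.βmax → γ ∈ Set.Icc P.γmin P.γmax →
        x ∈ IPila.dom f₁ → IPila.IsInexactProx f₀ f₁ P.τ α β x s y →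
        ∃ lam : ℝ, IPila.LineSearchReturns f₀ f₁ P.σ P.δ α β γ x s y lam ∧ lamMin ≤ lam) ∧
    -- bounded iterates converge to a stationary point
    (IPila.IsKLFunction (IPila.meritF (IPila.objective f₀ f₁)) →
      ∀ (α β γ lam : ℕ → ℝ) (x s y : ℕ → EuclideanSpace ℝ (Fin n)),
        IPila.IsRun f₀ f₁ P α β γ lam x s y →
        Bornology.IsBounded (Set.range x) →
        ∃ xstar : EuclideanSpace ℝ (Fin n),
          Filter.Tendsto x Filter.atTop (nhds xstar) ∧
          IPila.IsStationary (IPila.objective f₀ f₁) xstar) :=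
  ⟨IPila.exists_lineSearchReturns hf P, fun hKL _ _ _ _ _ _ _ hrun hbdd =>
    hrun.exists_tendsto_isStationary hf hKL hbdd⟩
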